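/- Let $F$ be a field of characteristic $0$, $r\ge 1$, and let $\pi$ be a permutation of $\{1,\dots,r\}$ with permutation matrix $w=(\delta_{j=\pi(i)})_{i,j}$. Let $\mathrm{Inv}(\pi^{-1})=\{(a,b): a<b,\ \pi^{-1}(a)>\pi^{-1}(b)\}$. Let $n$ be the upper triangular unipotent $r\times r$ matrix whose entry $n_{a,b}$ is a nonzero element of $F$ (a value of the free variable $n_{a,b}$; $F$ may be a field of rational functions and the $n_{a,b}$ independent indeterminates) if $(a,b)\in \mathrm{Inv}(\pi^{-1})$, is $1$ if $a=b$, and is $0$ otherwise. Then $(wn)_{k,j}=n_{\pi(k),j}$, so that $n_{a,b}$ stands in row $\pi^{-1}(a)$ and column $b$ of $wn$. Write $1_j$ for the entry $1$ in column $j$ and row $\pi^{-1}(j)$. Paths. A path in $wn$ is a nonempty sequence of nonzero entries of $wn$ in which each entry is followed by the nearest nonzero entry to its left in the same row, or by the nearest nonzero entry above it in the same column. Its length is the number of its entries minus $1$. For sets $A,B$ of nonzero entries with $|A|=|B|=m\ge 1$, let $\mathcal P(A\to B)$ be the collection of all sets of $m$ pairwise disjoint paths (no common entry), each leading from an element of $A$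 to an element of $B$, and let $\mathcal P_L(A\to B)$ be the subcollection of those sets in which every path of length at least $1$ that starts in the rightmost column starts by going left. Let $u(\mathbf p)$ be the product of all free variables traversed by the paths in $\mathbf p$, and let $\rho(1_j)$ be the product of the nonzero entries of the row of $wn$ that contains $1_j$. The map $R$. For $(a,b)\in\mathrm{Inv}(\pi^{-1})$ let $M(n_{a,b})$ be the submatrix of $wn$ with rows $\pi^{-1}(b),\dots,\pi^{-1}(a)$ and columns $b,\dots,r$. Let $D(n_{a,b})$ be the set of the entries $1_\mu$ in $M(n_{a,b})$, and let $O(n_{a,b})$ consist of the rightmost nonzero entry of the bottom row of $M(n_{a,b})$ and the rightmost nonzero entries of those rows of $M(n_{a,b})$ that contain an element of $D(n_{a,b})$ other than $1_b$. Put $$R(n_{a,b})=(-1)^{|D(n_{a,b})|-1}\,\frac{\sum_{\mathbf p\in\mathcal P(O(n_{a,b})\to D(n_{a,b}))}u(\mathbf p)}{\prod_{1_\mu\in D(n_{a,b})}\rho(1_\mu)},$$ and let $R_L(n_{a,b})$ be given by the same formula with $\mathcal P_L$ in place of $\mathcal P$. Let $wu$ be the matrix obtained from $wn$ by replacing each free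 variable $n_{a,b}$ by $R(n_{a,b})$, and write $u_{a,b}=(wu)_{\pi^{-1}(a),b}$. The matrices. For $1\le i\le r$ with $r-i+1>\pi(r)$ (hence $i\le r-1$), let $$T_i=\bigl((wu)_{k,\ell}\bigr)_{k,\ell\ge r-i+1},\qquad F_i=\bigl((wu)_{k,\ell}\bigr)_{k\ge r-i,\ k\ne r-i+1,\ \ell\ge r-i+1}.$$ For $k\ge r-i$, $k\neq\pi^{-1}(r)$, let $x^L_k$ be the row vector of length $i-1$ with entries $x^L_k(b)$, $r-i+1\le b\le r-1$, where $x^L_k(b)=R_L(n_{\pi(k),b})$ if $(\pi(k),b)\in\mathrm{Inv}(\pi^{-1})$, and $x^L_k(b)=(wu)_{k,b}$ otherwise. Let $T_i^L$ be the $(i-1)\times(i-1)$ matrix whose rows, from top to bottom, are the $x^L_k$ with * $k=r-i+2,\dots,r$ if $r-i+1>\pi^{-1}(r)$; * $k=r-i+1,\dots,r$ without $k=\pi^{-1}(r)$ if $r-i+1\le\pi^{-1}(r)$. Let $F_i^L$ be the $(i-1)\times(i-1)$ matrix whose rows, from top to bottom, are the $x^L_k$ with * $k=r-i+1,\ r-i+3,\dots,r$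 if $r-i+1>\pi^{-1}(r)$; * $k=r-i,\ r-i+3,\dots,r$ if $r-i+1=\pi^{-1}(r)$; * $k=r-i,\ r-i+2,\dots,r$ without $k=\pi^{-1}(r)$ if $r-i+1<\pi^{-1}(r)$. For $i=1$, $T_1^L$ and $F_1^L$ are empty matrices, with determinant $1$, and $u_{\pi(r+1),r}$ is read as $0$. Theorem. Assume $1\le i\le r$ and $r-i+1>\pi(r)$. (i) The rightmost column of $T_i$ has a nonzero entry, and $$\det T_i=(-1)^{s+i}\,u_{\pi(r-i+s),r}\,\det T_i^L,$$ where $s\in\{1,\dots,i\}$ is such that the highest nonzero entry of the rightmost column of $T_i$ lies in the $s$-th row of $T_i$, that is, in the $(r-i+s)$-th row of $wu$. (ii) We have $$\det F_i=\begin{cases} \dfrac{1}{n_{\pi(r-i+1),r}}\det T_i-\dfrac{(-1)^{i}}{n_{\pi(r-i+1),r}}\,u_{\pi(r-i+2),r}\,\det F_i^L & \text{if } r-i+1>\pi^{-1}(r),\\[2mm] (-1)^{i}\,u_{\pi(r-i+2),r}\,\det F_i^L & \text{if } r-i+1=\pi^{-1}(r),\\[1mm] (-1)^{r-\pi^{-1}(r)}\,\det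 F_i^L & \text{if } r-i+1<\pi^{-1}(r). \end{cases}$$ -/

import Mathlib

namespace SchubertCell

/-! Rows and columns are numbered `1, …, r` by natural numbers. An element of the symmetric group on
`{1, …, r}` is a permutation `π` of `ℕ` that fixes every number outside `{1, …, r}`. A position
`(k, j)` is the `k`-th row and the `j`-th column; the entry `n_{a,b}` of the matrix `n` stands at the
position `(π⁻¹ a, b)` of the matrix `wn`. -/

/-- The set `Inv(π⁻¹)` of pairs `(a, b)` with `a < b` and `π⁻¹ a > π⁻¹ b`: the indices of the free
variables. -/
def invSet (r : ℕ) (π : Equiv.Perm ℕ) : Finset (ℕ × ℕ) :=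
  (Finset.Icc 1 r ×ˢ Finset.Icc 1 r).filter fun p => p.1 < p.2 ∧ π.symm p.2 < π.symm p.1

/-- The entry `n_{a,b}`: it is `1` on the diagonal, the free variable `v a b` for `(a, b)` in
`Inv(π⁻¹)`, and `0` otherwise. -/
def nEntry {F : Type*} [Field F] (r : ℕ) (π : Equiv.Perm ℕ) (v : ℕ → ℕ → F) (a b : ℕ) : F :=
  if a = b then 1 else if (a, b) ∈ invSet r π then v a b else 0

/-- The entries of `wn`: `(wn)_{k,j} = n_{π(k),j}`. -/
def wn {F : Type*} [Field F] (r : ℕ) (π : Equiv.Perm ℕ) (v : ℕ → ℕ → F) (k j : ℕ) : F :=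
  nEntry r π v (π k) j

/-- The positions of the nonzero entries (ones and free variables) of `wn`. -/
def entries (r : ℕ) (π : Equiv.Perm ℕ) : Finset (ℕ × ℕ) :=
  (Finset.Icc 1 r ×ˢ Finset.Icc 1 r).filter fun p => p.2 = π p.1 ∨ (π p.1, p.2) ∈ invSet r π

/-- `q` is the neighbour of `p` to the left: no nonzero entry lies strictly between them. -/
def LeftStep (r : ℕ) (π : Equiv.Perm ℕ) (p q : ℕ × ℕ) : Prop :=
  q.1 = p.1 ∧ q.2 < p.2 ∧ ∀ c ∈ Finset.Ioo q.2 p.2, (p.1, c) ∉ entries r π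

/-- `q` is the neighbour of `p` above it: no nonzero entry lies strictly between them. -/
def UpStep (r : ℕ) (π : Equiv.Perm ℕ) (p q : ℕ × ℕ) : Prop :=
  q.2 = p.2 ∧ q.1 < p.1 ∧ ∀ k ∈ Finset.Ioo q.1 p.1, (k, p.2) ∉ entries r π

/-- One step of a path: to the neighbour to the left or to the neighbour above. -/
def Step (r : ℕ) (π : Equiv.Perm ℕ) (p q : ℕ × ℕ) : Prop :=
  LeftStep r π p q ∨ UpStep r π p q

instance (r : ℕ) (π : Equiv.Perm ℕ) : DecidableRel (Step r π) := fun _ _ => by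
  unfold Step LeftStep UpStep; infer_instance

/-- A path: a nonempty sequence of nonzero entries, each followed by a neighbour to its left or
above it. -/
def IsPath (r : ℕ) (π : Equiv.Perm ℕ) (l : List (ℕ × ℕ)) : Prop :=
  l ≠ [] ∧ (∀ e ∈ l, e ∈ entries r π) ∧ l.IsChain (Step r π)

instance (r : ℕ) (π : Equiv.Perm ℕ) : DecidablePred (IsPath r π) := fun _ => by
  unfold IsPath; infer_instance

/-- The finite set of all paths; see `mem_paths`. -/
def paths (r : ℕ) (π : Equiv.Perm ℕ) : Finset (List (ℕ × ℕ)) :=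
  ((entries r π).powerset.biUnion fun s => s.val.lists.toFinset).filter (IsPath r π)

theorem mem_paths (r : ℕ) (π : Equiv.Perm ℕ) (l : List (ℕ × ℕ)) :
    l ∈ paths r π ↔ IsPath r π l := by
  unfold paths
  rw [Finset.mem_filter, and_iff_right_iff_imp]
  rintro ⟨-, hmem, hchain⟩
  have h1 : l.IsChain (fun p q => q.1 + q.2 < p.1 + p.2) := by
    refine hchain.imp fun p q h => ?_
    rcases h with h | h <;> obtain ⟨h1, h2, -⟩ := h <;> omega
  have h2 : l.Nodup := by
    have : IsTrans (ℕ × ℕ) (fun p q => q.1 + q.2 < p.1 + p.2) := ⟨fun a b c h h' => by omega⟩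
    have h3 := List.isChain_iff_pairwise.1 h1
    exact h3.imp fun {a b} h hab => by subst hab; exact lt_irrefl _ h
  rw [Finset.mem_biUnion]
  refine ⟨⟨(l : Multiset (ℕ × ℕ)), Multiset.coe_nodup.2 h2⟩, ?_, ?_⟩
  · rw [Finset.mem_powerset]
    intro e he
    exact hmem e (by simpa using he)
  · simp

/-- `l` starts at a position in `A` and ends at a position in `B`. -/
def Connects (A B : Finset (ℕ × ℕ)) (l : List (ℕ × ℕ)) : Prop :=
  (∃ a ∈ A, l.head? = some a) ∧ ∃ b ∈ B, l.getLast? = some b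

instance (A B : Finset (ℕ × ℕ)) : DecidablePred (Connects A B) := fun _ => by
  unfold Connects; infer_instance

/-- The collection of all sets of `|A|` pairwise disjoint paths connecting elements of `A` to
elements of `B` (used for `|A| = |B|`). -/
def pathSets (r : ℕ) (π : Equiv.Perm ℕ) (A B : Finset (ℕ × ℕ)) : Finset (Finset (List (ℕ × ℕ))) :=
  ((paths r π).powersetCard A.card).filter fun P =>
    (∀ p ∈ P, Connects A B p) ∧ ∀ p ∈ P, ∀ q ∈ P, p ≠ q → ∀ e ∈ p, e ∉ q

/-- If the path has length at least one and its origin is in the rightmost column, then it starts by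
going left. -/
def StartsLeft (r : ℕ) : List (ℕ × ℕ) → Prop
  | x :: y :: _ => x.2 = r → y.1 = x.1 ∧ y.2 < x.2
  | _ => True

instance (r : ℕ) : DecidablePred (StartsLeft r)
  | [] => isTrue trivial
  | [_] => isTrue trivial
  | _ :: _ :: _ => by unfold StartsLeft; infer_instance

/-- The subcollection of those sets in which every path of length at least one whose origin is in
the rightmost column starts by going left. -/
def pathSetsL (r : ℕ) (π : Equiv.Perm ℕ) (A B : Finset (ℕ × ℕ)) :
    Finset (Finset (List (ℕ × ℕ))) :=
  (pathSets r π A B).filter fun P => ∀ p ∈ P, StartsLeft r p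

/-- The product of the free variables traversed by the paths of the set (the ones contribute `1`). -/
def weight {F : Type*} [Field F] (r : ℕ) (π : Equiv.Perm ℕ) (v : ℕ → ℕ → F)
    (P : Finset (List (ℕ × ℕ))) : F :=
  ∏ p ∈ P, (p.map fun e => wn r π v e.1 e.2).prod

/-- The nonzero entries in the submatrix `M_w(n_{a,b})` of `wn`, with rows `π⁻¹ b, …, π⁻¹ a` and
columns `b, …, r`. -/
def block (r : ℕ) (π : Equiv.Perm ℕ) (a b : ℕ) : Finset (ℕ × ℕ) :=
  (entries r π).filter fun p => π.symm b ≤ p.1 ∧ p.1 ≤ π.symm a ∧ b ≤ p.2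

/-- The destinations of `n_{a,b}`: the ones in `M_w(n_{a,b})`. -/
def dest (r : ℕ) (π : Equiv.Perm ℕ) (a b : ℕ) : Finset (ℕ × ℕ) :=
  (block r π a b).filter fun p => p.2 = π p.1

/-- The origins of `n_{a,b}`: the rightmost nonzero entry of the bottom row of `M_w(n_{a,b})`, and of
each row that contains a destination other than the top destination `1_b`. -/
def orig (r : ℕ) (π : Equiv.Perm ℕ) (a b : ℕ) : Finset (ℕ × ℕ) :=
  (block r π a b).filter fun p =>
    (∀ q ∈ block r π a b, q.1 = p.1 → q.2 ≤ p.2) ∧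
      (p.1 = π.symm a ∨ ∃ d ∈ dest r π a b, d ≠ (π.symm b, b) ∧ d.1 = p.1)

/-- The product of the nonzero entries in the `k`-th row of `wn`. -/
def rho {F : Type*} [Field F] (r : ℕ) (π : Equiv.Perm ℕ) (v : ℕ → ℕ → F) (k : ℕ) : F :=
  ∏ p ∈ (entries r π).filter (fun p => p.1 = k), wn r π v p.1 p.2

/-- `R(n_{a,b})`. -/
def R {F : Type*} [Field F] (r : ℕ) (π : Equiv.Perm ℕ) (v : ℕ → ℕ → F) (a b : ℕ) : F :=
  (-1) ^ ((dest r π a b).card - 1) *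
    ((∑ P ∈ pathSets r π (orig r π a b) (dest r π a b), weight r π v P) /
      ∏ d ∈ dest r π a b, rho r π v d.1)

/-- `R_L(n_{a,b})`. -/
def RL {F : Type*} [Field F] (r : ℕ) (π : Equiv.Perm ℕ) (v : ℕ → ℕ → F) (a b : ℕ) : F :=
  (-1) ^ ((dest r π a b).card - 1) *
    ((∑ P ∈ pathSetsL r π (orig r π a b) (dest r π a b), weight r π v P) /
      ∏ d ∈ dest r π a b, rho r π v d.1)

/-- `u_{a,b}`: each free variable `n_{a,b}` is replaced by `R(n_{a,b})`. -/
def uEntry {F : Type*} [Field F] (r : ℕ) (π : Equiv.Perm ℕ) (v : ℕ → ℕ → F) (a b : ℕ) : F :=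
  if (a, b) ∈ invSet r π then R r π v a b else nEntry r π v a b

/-- The entries of `wu`: `(wu)_{k,j} = u_{π(k),j}`. -/
def wu {F : Type*} [Field F] (r : ℕ) (π : Equiv.Perm ℕ) (v : ℕ → ℕ → F) (k j : ℕ) : F :=
  uEntry r π v (π k) j

/-- `T_i`: rows and columns `r-i+1, …, r` of `wu`. -/
def T {F : Type*} [Field F] (r : ℕ) (π : Equiv.Perm ℕ) (v : ℕ → ℕ → F) (i : ℕ) :
    Matrix (Fin i) (Fin i) F :=
  Matrix.of fun a c => wu r π v (r - i + 1 + a) (r - i + 1 + c)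

/-- `F_i`: rows `r-i, r-i+2, …, r` and columns `r-i+1, …, r` of `wu`. -/
def Fmat {F : Type*} [Field F] (r : ℕ) (π : Equiv.Perm ℕ) (v : ℕ → ℕ → F) (i : ℕ) :
    Matrix (Fin i) (Fin i) F :=
  Matrix.of fun a c =>
    wu r π v (if (a : ℕ) = 0 then r - i else r - i + 1 + a) (r - i + 1 + c)

/-- The entries `x^L_k(b)`. -/
def xL {F : Type*} [Field F] (r : ℕ) (π : Equiv.Perm ℕ) (v : ℕ → ℕ → F) (k b : ℕ) : F :=
  if (π k, b) ∈ invSet r π then RL r π v (π k) b else wu r π v k b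

/-- The index of the `(a+1)`-st row of `T_i^L`. The rows are `r-i+2, …, r` if `r-i+1 > π⁻¹(r)`, and
`r-i+1, …, r` without `π⁻¹(r)` otherwise. -/
def rowT (r : ℕ) (π : Equiv.Perm ℕ) (i a : ℕ) : ℕ :=
  if π.symm r < r - i + 1 then r - i + 2 + a
  else if r - i + 1 + a < π.symm r then r - i + 1 + a else r - i + 2 + a

/-- The index of the `(a+1)`-st row of `F_i^L`. The rows are `r-i+1, r-i+3, …, r` if
`r-i+1 > π⁻¹(r)`, they are `r-i, r-i+3, …, r` if `r-i+1 = π⁻¹(r)`, and `r-i, r-i+2, …, r` without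
`π⁻¹(r)` if `r-i+1 < π⁻¹(r)`. -/
def rowF (r : ℕ) (π : Equiv.Perm ℕ) (i a : ℕ) : ℕ :=
  if π.symm r < r - i + 1 then (if a = 0 then r - i + 1 else r - i + 2 + a)
  else if π.symm r = r - i + 1 then (if a = 0 then r - i else r - i + 2 + a)
  else if a = 0 then r - i
  else if r - i + 1 + a < π.symm r then r - i + 1 + a else r - i + 2 + a

/-- The matrix `T_i^L` of size `i - 1`, with columns `r-i+1, …, r-1`. -/
def TL {F : Type*} [Field F] (r : ℕ) (π : Equiv.Perm ℕ) (v : ℕ → ℕ → F) (i : ℕ) :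
    Matrix (Fin (i - 1)) (Fin (i - 1)) F :=
  Matrix.of fun a c => xL r π v (rowT r π i a) (r - i + 1 + c)

/-- The matrix `F_i^L` of size `i - 1`, with columns `r-i+1, …, r-1`. -/
def FL {F : Type*} [Field F] (r : ℕ) (π : Equiv.Perm ℕ) (v : ℕ → ℕ → F) (i : ℕ) :
    Matrix (Fin (i - 1)) (Fin (i - 1)) F :=
  Matrix.of fun a c => xL r π v (rowF r π i a) (r - i + 1 + c)

end SchubertCell

/-! ### Nonzero entries of `wn`: ones and crossings of row lines with column lines. -/

namespace SchubertCell

/-! For a fixed destination column `b`, let one path start in column `c` at the lowest entry in the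
rows up to `k`, and let the others start at the right ends of the rows after `π⁻¹ b`, up to `k`,
whose one lies in a column `≥ b`. Divide the sum over disjoint families by the products `rho` of the
destination rows, and give it a sign that counts the column lines to the right of `c`. This
quantity, `signedSum`, obeys a recursion in `(k, c)` in which `b` does not occur: it is unchanged
when row `k + 1` begins to the right of `c` (`signedSum_pass`), and at an entry of row `k + 1` that
is not a one it equals that entry times (value above minus value at the left neighbour)
(`signedSum_step`). The auxiliary paths disappear because such a path, when forced to run along its
whole row, contributes exactly the factor `rho` that is divided out, and because the alternative, in
which the two paths of the row exchange roles, is accounted for by the sign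
(`pathSum_insert_insert_leftCol`). At the right end of a row the value is the entry of `wu`,
including the entries 0 and 1.

The recursion is linear, so its solution is a combination of the values at the ones: `wu` is a
matrix of rows `rowVec`, independent of `b`, times the matrix `transition`, which is lower
triangular since paths never move right (`signedSum_eq_sum`, `wu_eq_sum`). The collection `P_L`
gives the same picture with upward steps in column `r` forbidden; this is the parameter `e`, with `e
= 0` for `P` and `e = r` for `P_L`. The two triangular factors have the same diagonal, with last
entry 1, so the determinants of size `i` and of size `i - 1` pick up the same factor (`det_wu`,
`det_xL`), and only determinants of `rowVec` remain to be compared.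

For these, the first step from the right end `(k + 1, r)` of a row goes up to the right end of row
`k`, or left. Hence row `k + 1` of the first kind is `n_{π(k+1),r}` times row `k` plus row `k + 1`
of the second kind, whose last coordinate is 0 (`rowVec_of_gt`). Row operations leave a single
nonzero entry in the last column, and expansion along it gives all the formulas except the first one
for `F_i`, which also needs linearity in the top row. -/

/-- The permutation `π` belongs to the symmetric group on `{1, …, r}`. -/
def FixesOutside (r : ℕ) (π : Equiv.Perm ℕ) : Prop :=
  ∀ k, k ∉ Finset.Icc 1 r → π k = k

theorem mem_Icc_perm {r : ℕ} {π : Equiv.Perm ℕ} (hπ : FixesOutside r π) (k : ℕ) :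
    (1 ≤ π k ∧ π k ≤ r) ↔ 1 ≤ k ∧ k ≤ r := by
  constructor
  · intro h
    by_contra hk
    have := hπ k (by simpa using hk)
    rw [this] at h
    exact hk h
  · intro h
    by_contra hk
    have h1 := π.injective (hπ (π k) (by simpa using hk))
    rw [h1] at hk
    exact hk h

theorem mem_Icc_perm_symm {r : ℕ} {π : Equiv.Perm ℕ} (hπ : FixesOutside r π)
    (k : ℕ) : (1 ≤ π.symm k ∧ π.symm k ≤ r) ↔ 1 ≤ k ∧ k ≤ r := by
  have := mem_Icc_perm hπ (π.symm k)
  rw [Equiv.apply_symm_apply] at this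
  exact this.symm

theorem mem_invSet_iff {r : ℕ} {π : Equiv.Perm ℕ}
    (a b : ℕ) : (a, b) ∈ invSet r π ↔ 1 ≤ a ∧ b ≤ r ∧ a < b ∧ π.symm b < π.symm a := by
  simp only [invSet, Finset.mem_filter, Finset.mem_product, Finset.mem_Icc]
  omega

/-- The row lines of `wn` start at the ones and extend to the right, the column lines start at the
ones and extend downwards; the nonzero entries are the ones and the crossings. -/
theorem mem_entries_iff {r : ℕ} {π : Equiv.Perm ℕ} (hπ : FixesOutside r π)
    (k c : ℕ) :
    (k, c) ∈ entries r π ↔ 1 ≤ k ∧ k ≤ r ∧ π k ≤ c ∧ π.symm c ≤ k := by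
  have h1 := mem_Icc_perm hπ k
  have h2 := mem_Icc_perm_symm hπ c
  have h3 : c = π k ↔ π.symm c = k := by rw [Equiv.symm_apply_eq]
  have h4 : π.symm c = 0 → c = 0 := by
    rw [Equiv.symm_apply_eq, hπ 0 (by simp)]
    exact id
  simp only [entries, Finset.mem_filter, Finset.mem_product, Finset.mem_Icc, mem_invSet_iff,
    Equiv.symm_apply_apply]
  constructor
  · rintro ⟨⟨h5, h6⟩, h7⟩
    omega
  · rintro ⟨h5, h6, h7, h8⟩
    omega

theorem wn_ne_zero {F : Type*} [Field F] {r : ℕ} {π : Equiv.Perm ℕ} {v : ℕ → ℕ → F}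
    (hv : ∀ p ∈ invSet r π, v p.1 p.2 ≠ 0) {k c : ℕ} (h : (k, c) ∈ entries r π) :
    wn r π v k c ≠ 0 := by
  simp only [entries, Finset.mem_filter] at h
  unfold wn nEntry
  split_ifs with h1 h2
  · exact one_ne_zero
  · exact hv _ h2
  · rcases h.2 with h3 | h3
    · exact absurd h3.symm h1
    · exact absurd h3 h2

theorem wn_perm {F : Type*} [Field F] (r : ℕ) (π : Equiv.Perm ℕ) (v : ℕ → ℕ → F) (k : ℕ) :
    wn r π v k (π k) = 1 := by
  simp [wn, nEntry]

/-! ### Neighbours of an entry and right ends of rows. -/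

/-- The column of the left neighbour of the entry in row `k` and column `c`. -/
def leftCol (r : ℕ) (π : Equiv.Perm ℕ) (k c : ℕ) : ℕ :=
  ((Finset.range c).filter fun j => (k, j) ∈ entries r π).sup id

/-- The row of the lowest nonzero entry of column `c` in the rows up to `k`. -/
def lowRow (r : ℕ) (π : Equiv.Perm ℕ) (k c : ℕ) : ℕ :=
  ((Finset.range (k + 1)).filter fun l => (l, c) ∈ entries r π).sup id

/-- The column of the rightmost nonzero entry of row `k`. -/
def rightCol (r : ℕ) (π : Equiv.Perm ℕ) (k : ℕ) : ℕ :=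
  ((Finset.range (r + 1)).filter fun c => (k, c) ∈ entries r π).sup id

theorem sup_id_mem_of_nonempty {s : Finset ℕ} (hs : s.Nonempty) : s.sup id ∈ s := by
  obtain ⟨x, hx, h⟩ := Finset.exists_mem_eq_sup s hs id
  rw [h]
  exact hx

section

variable {r : ℕ} {π : Equiv.Perm ℕ}

theorem perm_mem_entries (hπ : FixesOutside r π) {k : ℕ} (h1 : 1 ≤ k) (h2 : k ≤ r) :
    (k, π k) ∈ entries r π := by
  simp only [entries, Finset.mem_filter, Finset.mem_product, Finset.mem_Icc]
  exact ⟨⟨⟨h1, h2⟩, (mem_Icc_perm hπ k).2 ⟨h1, h2⟩⟩, Or.inl trivial⟩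

theorem leftCol_spec (hπ : FixesOutside r π) {k c : ℕ} (h1 : 1 ≤ k) (h2 : k ≤ r) (hc : π k < c) :
    (k, leftCol r π k c) ∈ entries r π ∧ leftCol r π k c < c := by
  have := sup_id_mem_of_nonempty (s := (Finset.range c).filter fun j => (k, j) ∈ entries r π)
    ⟨π k, by simp [hc, perm_mem_entries hπ h1 h2]⟩
  simp only [Finset.mem_filter, Finset.mem_range] at this
  exact ⟨this.2, this.1⟩

theorem le_leftCol {k c j : ℕ} (hj : (k, j) ∈ entries r π) (hjc : j < c) :
    j ≤ leftCol r π k c :=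
  Finset.le_sup (f := id) (by simp [hj, hjc])

theorem lowRow_spec (hπ : FixesOutside r π) {k c : ℕ} (h1 : 1 ≤ c) (h2 : c ≤ r) (hc : π.symm c ≤ k) :
    (lowRow r π k c, c) ∈ entries r π ∧ lowRow r π k c ≤ k := by
  have hm : (π.symm c, c) ∈ entries r π := by
    have h := (mem_Icc_perm_symm hπ c).2 ⟨h1, h2⟩
    have := perm_mem_entries hπ h.1 h.2
    rwa [Equiv.apply_symm_apply] at this
  have := sup_id_mem_of_nonempty (s := (Finset.range (k + 1)).filter fun j => (j, c) ∈ entries r π)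
    ⟨π.symm c, by simp [hm]; omega⟩
  simp only [Finset.mem_filter, Finset.mem_range] at this
  exact ⟨this.2, by have := this.1; unfold lowRow; omega⟩

theorem le_lowRow {k c j : ℕ} (hj : (j, c) ∈ entries r π) (hjk : j ≤ k) :
    j ≤ lowRow r π k c :=
  Finset.le_sup (f := id) (by simp [hj]; omega)

theorem lowRow_self {k c : ℕ} (h : (k, c) ∈ entries r π) : lowRow r π k c = k := by
  apply le_antisymm _ (le_lowRow h le_rfl)
  refine Finset.sup_le fun j hj => ?_
  simp only [Finset.mem_filter, Finset.mem_range] at hj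
  simp only [id]
  omega

theorem lowRow_pred {k c : ℕ} (hk : 1 ≤ k) (h : (k, c) ∉ entries r π) :
    lowRow r π k c = lowRow r π (k - 1) c := by
  unfold lowRow
  congr 1
  ext j
  simp only [Finset.mem_filter, Finset.mem_range, and_congr_left_iff]
  intro hj
  have : j ≠ k := by rintro rfl; exact h hj
  omega

theorem rightCol_spec (hπ : FixesOutside r π) {k : ℕ} (h1 : 1 ≤ k) (h2 : k ≤ r) :
    (k, rightCol r π k) ∈ entries r π := by
  have h := (mem_Icc_perm hπ k).2 ⟨h1, h2⟩
  have := sup_id_mem_of_nonempty (s := (Finset.range (r + 1)).filter fun j => (k, j) ∈ entries r π)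
    ⟨π k, by simp [perm_mem_entries hπ h1 h2]; omega⟩
  simp only [Finset.mem_filter, Finset.mem_range] at this
  exact this.2

theorem le_of_mem_entries {k c : ℕ} (hj : (k, c) ∈ entries r π) : 1 ≤ c ∧ c ≤ r := by
  simp only [entries, Finset.mem_filter, Finset.mem_product, Finset.mem_Icc] at hj
  exact hj.1.2

theorem le_rightCol {k c : ℕ} (hj : (k, c) ∈ entries r π) : c ≤ rightCol r π k :=
  Finset.le_sup (f := id) (by
    have := le_of_mem_entries hj
    simp [hj]
    omega)

theorem leftStep_iff (hπ : FixesOutside r π) {k c : ℕ} (h1 : 1 ≤ k) (h2 : k ≤ r) (hc : π k < c)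
    (q : ℕ × ℕ) :
    q ∈ entries r π ∧ LeftStep r π (k, c) q ↔ q = (k, leftCol r π k c) := by
  obtain ⟨h3, h4⟩ := leftCol_spec hπ h1 h2 hc
  constructor
  · rintro ⟨hq, h5, h6, h7⟩
    obtain ⟨q1, q2⟩ := q
    simp only at h5 h6 h7
    subst h5
    have h8 := le_leftCol hq h6
    rcases h8.lt_or_eq with h9 | h9
    · exact absurd h3 (h7 _ (by simp [h9, h4]))
    · rw [h9]
  · rintro rfl
    refine ⟨h3, rfl, h4, fun j hj hj' => ?_⟩
    simp only [Finset.mem_Ioo] at hj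
    exact absurd (le_leftCol hj' hj.2) (by simpa using hj.1)

theorem upStep_iff (hπ : FixesOutside r π) {k c : ℕ} (h1 : 1 ≤ c) (h2 : c ≤ r)
    (hc : π.symm c < k) (q : ℕ × ℕ) :
    q ∈ entries r π ∧ UpStep r π (k, c) q ↔ q = (lowRow r π (k - 1) c, c) := by
  obtain ⟨h3, h4⟩ := lowRow_spec hπ (k := k - 1) h1 h2 (by omega)
  constructor
  · rintro ⟨hq, h5, h6, h7⟩
    obtain ⟨q1, q2⟩ := q
    simp only at h5 h6 h7
    subst h5
    have h8 := le_lowRow (k := k - 1) hq (by omega)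
    rcases h8.lt_or_eq with h9 | h9
    · exact absurd h3 (h7 _ (by simp [h9]; omega))
    · rw [← h9]
  · rintro rfl
    refine ⟨h3, rfl, by simp only; omega, fun j hj hj' => ?_⟩
    simp only [Finset.mem_Ioo] at hj hj'
    have := le_lowRow (k := k - 1) hj' (by omega)
    omega

end

/-! ### Families of disjoint paths with one column closed to upward steps. -/

/-- A step of a path that does not leave a position of the column `e` by going up. -/
def StepAvoid (r : ℕ) (π : Equiv.Perm ℕ) (e : ℕ) (p q : ℕ × ℕ) : Prop :=
  LeftStep r π p q ∨ (UpStep r π p q ∧ p.2 ≠ e)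

/-- A set of disjoint paths with steps in `StepAvoid`, one for each element of `A`, connecting
elements of `A` to elements of `B`. -/
structure IsFamily (r : ℕ) (π : Equiv.Perm ℕ) (e : ℕ) (A B : Finset (ℕ × ℕ))
    (P : Finset (List (ℕ × ℕ))) : Prop where
  card : P.card = A.card
  mem : ∀ p ∈ P, ∀ x ∈ p, x ∈ entries r π
  chain : ∀ p ∈ P, p.IsChain (StepAvoid r π e)
  conn : ∀ p ∈ P, Connects A B p
  disj : ∀ p ∈ P, ∀ q ∈ P, ∀ x ∈ p, x ∈ q → p = q

open Classical in
/-- The finite set of all `P` with `IsFamily r π e A B P`. -/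
noncomputable def families (r : ℕ) (π : Equiv.Perm ℕ) (e : ℕ) (A B : Finset (ℕ × ℕ)) :
    Finset (Finset (List (ℕ × ℕ))) :=
  (paths r π).powerset.filter (IsFamily r π e A B)

section

variable {r : ℕ} {π : Equiv.Perm ℕ} {e : ℕ}

theorem StepAvoid.step {p q : ℕ × ℕ} (h : StepAvoid r π e p q) : Step r π p q :=
  h.imp id And.left

theorem mem_families {A B : Finset (ℕ × ℕ)} {P : Finset (List (ℕ × ℕ))} :
    P ∈ families r π e A B ↔ IsFamily r π e A B P := by
  simp only [families, Finset.mem_filter, Finset.mem_powerset, and_iff_right_iff_imp]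
  intro h p hp
  refine (mem_paths r π p).2 ⟨?_, h.mem p hp, (h.chain p hp).imp fun _ _ h => h.step⟩
  rintro rfl
  obtain ⟨⟨a, -, ha⟩, -⟩ := h.conn _ hp
  simp at ha

theorem le_of_isChain {x : ℕ × ℕ} {l : List (ℕ × ℕ)} (h : (x :: l).IsChain (StepAvoid r π e))
    {y : ℕ × ℕ} (hy : y ∈ l) : y.1 ≤ x.1 ∧ y.2 ≤ x.2 ∧ y ≠ x := by
  have h1 : (x :: l).IsChain (fun p q => q.1 ≤ p.1 ∧ q.2 ≤ p.2 ∧ q.1 + q.2 < p.1 + p.2) := by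
    refine h.imp fun p q h => ?_
    rcases h.step with h | h <;> obtain ⟨h1, h2, -⟩ := h <;> omega
  have : IsTrans (ℕ × ℕ) (fun p q => q.1 ≤ p.1 ∧ q.2 ≤ p.2 ∧ q.1 + q.2 < p.1 + p.2) :=
    ⟨fun a b c h h' => by omega⟩
  have h3 := List.rel_of_pairwise_cons (List.isChain_iff_pairwise.1 h1) hy
  exact ⟨h3.1, h3.2.1, by rintro rfl; omega⟩

theorem le_of_mem_path {x y : ℕ × ℕ} {l : List (ℕ × ℕ)} (h : l.IsChain (StepAvoid r π e))
    (hx : l.head? = some x) (hy : y ∈ l) : y.1 ≤ x.1 ∧ y.2 ≤ x.2 := by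
  obtain ⟨t, rfl⟩ := List.head?_eq_some_iff.1 hx
  rcases List.mem_cons.1 hy with rfl | hy
  · exact ⟨le_rfl, le_rfl⟩
  · exact ⟨(le_of_isChain h hy).1, (le_of_isChain h hy).2.1⟩

/-- Pigeonhole: disjoint paths have distinct origins, and there are as many paths as elements of
`A`. -/
theorem IsFamily.exists_head {A B : Finset (ℕ × ℕ)} {P : Finset (List (ℕ × ℕ))}
    (h : IsFamily r π e A B P) {a : ℕ × ℕ} (ha : a ∈ A) : ∃ p ∈ P, p.head? = some a := by
  have h1 := h.conn
  choose f hf hf' using fun p hp => (h1 p hp).1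
  refine (Finset.surj_on_of_inj_on_of_card_le f hf ?_ h.card.ge a ha).imp fun p hp => ?_
  · intro p q hp hq hpq
    exact h.disj p hp q hq (f p hp) (List.mem_of_head? (hf' p hp))
      (hpq ▸ List.mem_of_head? (hf' q hq))
  · obtain ⟨hp, rfl⟩ := hp
    exact ⟨hp, hf' p hp⟩

theorem IsFamily.exists_getLast {A B : Finset (ℕ × ℕ)} {P : Finset (List (ℕ × ℕ))}
    (h : IsFamily r π e A B P) (hAB : A.card = B.card) {b : ℕ × ℕ} (hb : b ∈ B) :
    ∃ p ∈ P, p.getLast? = some b := by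
  have h1 := h.conn
  choose f hf hf' using fun p hp => (h1 p hp).2
  refine (Finset.surj_on_of_inj_on_of_card_le f hf ?_ (h.card.trans hAB).ge b hb).imp
    fun p hp => ?_
  · intro p q hp hq hpq
    exact h.disj p hp q hq (f p hp) (List.mem_of_getLast? (hf' p hp))
      (hpq ▸ List.mem_of_getLast? (hf' q hq))
  · obtain ⟨hp, rfl⟩ := hp
    exact ⟨hp, hf' p hp⟩

theorem IsFamily.eq_of_head {A B : Finset (ℕ × ℕ)} {P : Finset (List (ℕ × ℕ))}
    (h : IsFamily r π e A B P) {p q : List (ℕ × ℕ)} (hp : p ∈ P) (hq : q ∈ P) {a : ℕ × ℕ}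
    (hpa : p.head? = some a) (hqa : a ∈ q) : p = q :=
  h.disj p hp q hq a (List.mem_of_head? hpa) hqa

/-- The path is extended by the new origin `x` if its origin is `y`. -/
def extendPath (x y : ℕ × ℕ) (l : List (ℕ × ℕ)) : List (ℕ × ℕ) :=
  if l.head? = some y then x :: l else l

/-- The first position is removed from the path if it is `x`. -/
def dropOrigin (x : ℕ × ℕ) (l : List (ℕ × ℕ)) : List (ℕ × ℕ) :=
  if l.head? = some x then l.tail else l

theorem mem_extendPath {x y z : ℕ × ℕ} {l : List (ℕ × ℕ)} (h : z ∈ extendPath x y l) :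
    z ∈ l ∨ (z = x ∧ l.head? = some y) := by
  unfold extendPath at h
  split_ifs at h with h1
  · rcases List.mem_cons.1 h with h | h
    · exact Or.inr ⟨h, h1⟩
    · exact Or.inl h
  · exact Or.inl h

theorem mem_of_mem_dropOrigin {x z : ℕ × ℕ} {l : List (ℕ × ℕ)} (h : z ∈ dropOrigin x l) : z ∈ l := by
  unfold dropOrigin at h
  split_ifs at h with h1
  · exact List.mem_of_mem_tail h
  · exact h

theorem dropOrigin_extendPath {x y : ℕ × ℕ} {l : List (ℕ × ℕ)} (h : x ∉ l) :
    dropOrigin x (extendPath x y l) = l := by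
  unfold dropOrigin extendPath
  split_ifs with h1 h2 h3
  · rfl
  · simp at h2
  · exact absurd (List.mem_of_head? h3) h
  · rfl

end

/-! ### Path sums and their expansion by the first step. -/

/-- The sum of the weights of the families of disjoint paths from `A` to `B`; it is zero if `A` and
`B` have different cardinalities. -/
noncomputable def pathSum {F : Type*} [Field F] (r : ℕ) (π : Equiv.Perm ℕ) (v : ℕ → ℕ → F) (e : ℕ)
    (A B : Finset (ℕ × ℕ)) : F :=
  if A.card = B.card then ∑ P ∈ families r π e A B, weight r π v P else 0

/-- No other element of `A` lies weakly below and to the right of `x`. -/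
def IsCorner (A : Finset (ℕ × ℕ)) (x : ℕ × ℕ) : Prop :=
  ∀ a ∈ A, x.1 ≤ a.1 → x.2 ≤ a.2 → a = x

section

variable {r : ℕ} {π : Equiv.Perm ℕ} {e : ℕ}

theorem StepAvoid.le_ne {x y : ℕ × ℕ} (h : StepAvoid r π e x y) : y.1 ≤ x.1 ∧ y.2 ≤ x.2 ∧ y ≠ x :=
  le_of_isChain (l := [y]) (by simpa using h) (by simp)

/-- Paths move only up and left, so a path through `x` would have its origin weakly below and to the
right of `x`. Thus prepending a corner to one path never creates an intersection. -/
theorem IsFamily.not_mem_of_isCorner {A B : Finset (ℕ × ℕ)} {x y : ℕ × ℕ} (hx : IsCorner A x)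
    (hxy : StepAvoid r π e x y) {P : Finset (List (ℕ × ℕ))}
    (h : IsFamily r π e (insert y (A.erase x)) B P) {p : List (ℕ × ℕ)} (hp : p ∈ P) : x ∉ p := by
  intro hxp
  obtain ⟨⟨a, ha, hpa⟩, -⟩ := h.conn p hp
  have h1 := le_of_mem_path (h.chain p hp) hpa hxp
  have h2 := hxy.le_ne
  rcases Finset.mem_insert.1 ha with rfl | ha
  · exact h2.2.2 (Prod.ext (le_antisymm h2.1 h1.1) (le_antisymm h2.2.1 h1.2))
  · rw [Finset.mem_erase] at ha
    exact ha.1 (hx a ha.2 h1.1 h1.2)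

theorem IsFamily.extend {A B : Finset (ℕ × ℕ)} {x y : ℕ × ℕ} (hxA : x ∈ A) (hx : IsCorner A x)
    (hxe : x ∈ entries r π) (hxy : StepAvoid r π e x y) (hyA : y ∉ A) {P : Finset (List (ℕ × ℕ))}
    (h : IsFamily r π e (insert y (A.erase x)) B P) :
    IsFamily r π e A B (P.image (extendPath x y)) := by
  have hinj : Set.InjOn (extendPath x y) P := fun p hp q hq hpq => by
    rw [← dropOrigin_extendPath (y := y) (h.not_mem_of_isCorner hx hxy hp), hpq,
      dropOrigin_extendPath (h.not_mem_of_isCorner hx hxy hq)]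
  refine ⟨?_, ?_, ?_, ?_, ?_⟩
  · rw [Finset.card_image_of_injOn hinj, h.card, Finset.card_insert_of_notMem,
      Finset.card_erase_add_one hxA]
    exact fun hy => hyA (Finset.mem_of_mem_erase hy)
  · simp only [Finset.forall_mem_image]
    intro p hp z hz
    rcases mem_extendPath hz with hz | ⟨rfl, -⟩
    · exact h.mem p hp z hz
    · exact hxe
  · simp only [Finset.forall_mem_image]
    intro p hp
    unfold extendPath
    split_ifs with h1
    · rw [List.isChain_cons]
      refine ⟨fun z hz => ?_, h.chain p hp⟩
      rw [h1, Option.mem_some] at hz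
      exact hz ▸ hxy
    · exact h.chain p hp
  · simp only [Finset.forall_mem_image]
    intro p hp
    obtain ⟨⟨a, ha, hpa⟩, b, hb, hpb⟩ := h.conn p hp
    unfold extendPath
    split_ifs with h1
    · exact ⟨⟨x, hxA, rfl⟩, b, hb, by simp [List.getLast?_cons, hpb]⟩
    · refine ⟨⟨a, ?_, hpa⟩, b, hb, hpb⟩
      rcases Finset.mem_insert.1 ha with rfl | ha
      · exact absurd hpa h1
      · exact Finset.mem_of_mem_erase ha
  · simp only [Finset.forall_mem_image]
    intro p hp q hq z hz hz'
    rcases mem_extendPath hz with h1 | ⟨rfl, h1⟩ <;> rcases mem_extendPath hz' with h2 | ⟨h3, h2⟩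
    · rw [h.disj p hp q hq z h1 h2]
    · exact absurd (h3 ▸ h1) (h.not_mem_of_isCorner hx hxy hp)
    · exact absurd h2 (h.not_mem_of_isCorner hx hxy hq)
    · rw [h.eq_of_head hp hq h1 (List.mem_of_head? h2)]

/-- Inverse of `IsFamily.extend`. As `x` is not a destination, its path has a second entry `y`;
disjointness keeps `y` away from the other origins. -/
theorem IsFamily.drop {A B : Finset (ℕ × ℕ)} {x : ℕ × ℕ} (hxA : x ∈ A) (hxB : x ∉ B)
    {P : Finset (List (ℕ × ℕ))} (h : IsFamily r π e A B P) :
    ∃ y, y ∈ entries r π ∧ StepAvoid r π e x y ∧ y ∉ A ∧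
      IsFamily r π e (insert y (A.erase x)) B (P.image (dropOrigin x)) ∧
      (P.image (dropOrigin x)).image (extendPath x y) = P := by
  obtain ⟨p, hp, hpx⟩ := h.exists_head hxA
  obtain ⟨t, rfl⟩ := List.head?_eq_some_iff.1 hpx
  obtain ⟨b, hb, hpb⟩ := (h.conn _ hp).2
  rcases t with _ | ⟨y, t⟩
  · simp only [List.getLast?_singleton, Option.some.injEq] at hpb
    exact absurd (hpb ▸ hb) hxB
  have hch := h.chain _ hp
  have hxy : StepAvoid r π e x y := (List.isChain_cons_cons.1 hch).1
  have hyA : y ∉ A := by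
    intro hy
    obtain ⟨q, hq, hqy⟩ := h.exists_head hy
    have := h.eq_of_head hq hp hqy (by simp)
    rw [this, List.head?_cons, Option.some.injEq] at hqy
    exact hxy.le_ne.2.2 hqy.symm
  have hd : dropOrigin x (x :: y :: t) = y :: t := by simp [dropOrigin]
  have hd' : ∀ q ∈ P, q ≠ x :: y :: t → q.head? ≠ some x := fun q hq hne hqx =>
    hne (h.eq_of_head hq hp hqx (by simp))
  have hd2 : ∀ q ∈ P, q ≠ x :: y :: t → dropOrigin x q = q := fun q hq hne => by
    rw [dropOrigin, if_neg (hd' q hq hne)]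
  have hex : ∀ q ∈ P, extendPath x y (dropOrigin x q) = q := by
    intro q hq
    by_cases hne : q = x :: y :: t
    · rw [hne, hd]
      simp [extendPath]
    · rw [hd2 q hq hne, extendPath, if_neg]
      intro hqy
      exact hne (h.eq_of_head hq hp hqy (by simp))
  have hinj : Set.InjOn (dropOrigin x) P := fun p hp q hq hpq => by
    rw [← hex p hp, hpq, hex q hq]
  refine ⟨y, h.mem _ hp y (by simp), hxy, hyA, ⟨?_, ?_, ?_, ?_, ?_⟩, ?_⟩
  · rw [Finset.card_image_of_injOn hinj, h.card, Finset.card_insert_of_notMem,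
      Finset.card_erase_add_one hxA]
    exact fun hy => hyA (Finset.mem_of_mem_erase hy)
  · simp only [Finset.forall_mem_image]
    intro q hq z hz
    exact h.mem q hq z (mem_of_mem_dropOrigin hz)
  · simp only [Finset.forall_mem_image]
    intro q hq
    unfold dropOrigin
    split_ifs
    · exact (h.chain q hq).tail
    · exact h.chain q hq
  · simp only [Finset.forall_mem_image]
    intro q hq
    by_cases hne : q = x :: y :: t
    · rw [hne, hd]
      refine ⟨⟨y, by simp, rfl⟩, b, hb, ?_⟩
      rwa [List.getLast?_cons_cons] at hpb
    · rw [hd2 q hq hne]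
      obtain ⟨⟨a, ha, hqa⟩, hq2⟩ := h.conn q hq
      refine ⟨⟨a, ?_, hqa⟩, hq2⟩
      refine Finset.mem_insert_of_mem (Finset.mem_erase.2 ⟨?_, ha⟩)
      rintro rfl
      exact hd' q hq hne hqa
  · simp only [Finset.forall_mem_image]
    intro q hq q' hq' z hz hz'
    rw [h.disj q hq q' hq' z (mem_of_mem_dropOrigin hz) (mem_of_mem_dropOrigin hz')]
  · rw [Finset.image_image]
    exact (Finset.image_congr hex).trans Finset.image_id

theorem IsFamily.weight_extend {F : Type*} [Field F] (v : ℕ → ℕ → F) {A B : Finset (ℕ × ℕ)}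
    {x y : ℕ × ℕ} (hx : IsCorner A x) (hxy : StepAvoid r π e x y)
    {P : Finset (List (ℕ × ℕ))} (h : IsFamily r π e (insert y (A.erase x)) B P) :
    weight r π v (P.image (extendPath x y)) = wn r π v x.1 x.2 * weight r π v P := by
  have hinj : Set.InjOn (extendPath x y) P := fun p hp q hq hpq => by
    rw [← dropOrigin_extendPath (y := y) (h.not_mem_of_isCorner hx hxy hp), hpq,
      dropOrigin_extendPath (h.not_mem_of_isCorner hx hxy hq)]
  obtain ⟨p, hp, hpy⟩ := h.exists_head (Finset.mem_insert_self y _)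
  unfold weight
  rw [Finset.prod_image hinj, ← Finset.mul_prod_erase P _ hp, ← Finset.mul_prod_erase P _ hp,
    ← mul_assoc]
  congr 1
  · simp [extendPath, hpy]
  · refine Finset.prod_congr rfl fun q hq => ?_
    rw [Finset.mem_erase] at hq
    rw [extendPath, if_neg]
    intro hqy
    exact hq.1 (h.eq_of_head hq.2 hp hqy (List.mem_of_head? hpy))

open Classical in
/-- The first step of the path that starts at the corner `x`. -/
theorem pathSum_step {F : Type*} [Field F] (v : ℕ → ℕ → F) {A B : Finset (ℕ × ℕ)}
    {x : ℕ × ℕ} (hAB : A.card = B.card) (hxA : x ∈ A) (hxB : x ∉ B) (hx : IsCorner A x)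
    (hxe : x ∈ entries r π) :
    pathSum r π v e A B = wn r π v x.1 x.2 *
      ∑ y ∈ (entries r π).filter (StepAvoid r π e x),
        pathSum r π v e (insert y (A.erase x)) B := by
  have hA := Finset.card_erase_add_one hxA
  -- If `y` is already an origin, the new origin set is too small and its path sum is 0 by
  -- convention. These terms may therefore stay in the sum although no disjoint family takes that
  -- step.
  have h1 : ∀ y, (insert y (A.erase x)).card = B.card ↔ y ∉ A ∨ y = x := by
    intro y
    by_cases hy : y ∈ A.erase x
    · rw [Finset.insert_eq_of_mem hy]
      rw [Finset.mem_erase] at hy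
      refine ⟨fun h => by omega, fun h => ?_⟩
      rcases h with h | h
      · exact absurd hy.2 h
      · exact absurd h hy.1
    · rw [Finset.card_insert_of_notMem hy]
      refine ⟨fun _ => ?_, fun _ => by omega⟩
      rw [Finset.mem_erase] at hy
      tauto
  have h2 : ∑ y ∈ (entries r π).filter (StepAvoid r π e x),
        pathSum r π v e (insert y (A.erase x)) B =
      ∑ y ∈ ((entries r π).filter (StepAvoid r π e x)).filter (· ∉ A),
        ∑ P ∈ families r π e (insert y (A.erase x)) B, weight r π v P := by
    rw [Finset.sum_filter (· ∉ A)]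
    refine Finset.sum_congr rfl fun y hy => ?_
    have h3 : y ≠ x := (Finset.mem_filter.1 hy).2.le_ne.2.2
    unfold pathSum
    simp only [h1, h3, or_false]
  rw [h2, pathSum, if_pos hAB, Finset.sum_sigma', Finset.mul_sum]
  symm
  refine Finset.sum_bij (fun s _ => s.2.image (extendPath x s.1)) ?_ ?_ ?_ ?_
  · rintro ⟨y, P⟩ h
    simp only [Finset.mem_sigma, Finset.mem_filter, mem_families] at h ⊢
    exact h.2.extend hxA hx hxe h.1.1.2 h.1.2
  · rintro ⟨y, P⟩ h ⟨y', P'⟩ h' heq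
    simp only [Finset.mem_sigma, Finset.mem_filter, mem_families] at h h' heq
    have key : ∀ {y : ℕ × ℕ} {P : Finset (List (ℕ × ℕ))}, StepAvoid r π e x y →
        IsFamily r π e (insert y (A.erase x)) B P →
        (P.image (extendPath x y)).image (dropOrigin x) = P := by
      intro y P hxy hP
      rw [Finset.image_image]
      refine (Finset.image_congr fun p hp => ?_).trans Finset.image_id
      exact dropOrigin_extendPath (hP.not_mem_of_isCorner hx hxy hp)
    have hPP : P = P' := by rw [← key h.1.1.2 h.2, heq, key h'.1.1.2 h'.2]
    subst hPP
    obtain ⟨p, hp, hpy⟩ := h.2.exists_head (Finset.mem_insert_self y _)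
    obtain ⟨⟨a, ha, hpa⟩, -⟩ := h'.2.conn p hp
    rw [hpy, Option.some.injEq] at hpa
    subst hpa
    rcases Finset.mem_insert.1 ha with rfl | ha
    · rfl
    · exact absurd (Finset.mem_of_mem_erase ha) h.1.2
  · intro P hP
    rw [mem_families] at hP
    obtain ⟨y, hy, hxy, hyA, h4, h5⟩ := hP.drop hxA hxB
    exact ⟨⟨y, P.image (dropOrigin x)⟩,
      by simp only [Finset.mem_sigma, Finset.mem_filter, mem_families]; exact ⟨⟨⟨hy, hxy⟩, hyA⟩, h4⟩,
      h5⟩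
  · rintro ⟨y, P⟩ h
    simp only [Finset.mem_sigma, Finset.mem_filter, mem_families] at h
    exact (h.2.weight_extend v hx h.1.1.2).symm

/-- A path that starts at a destination without outgoing steps stays there. -/
theorem pathSum_absorb {F : Type*} [Field F] (v : ℕ → ℕ → F) {A B : Finset (ℕ × ℕ)}
    {x : ℕ × ℕ} (hxA : x ∈ A) (hxB : x ∈ B) (hxe : x ∈ entries r π)
    (hx : ∀ y ∈ entries r π, ¬ StepAvoid r π e x y) :
    pathSum r π v e A B =
      wn r π v x.1 x.2 * pathSum r π v e (A.erase x) (B.erase x) := by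
  have hA := Finset.card_erase_add_one hxA
  have hB := Finset.card_erase_add_one hxB
  have hcard : (A.erase x).card = (B.erase x).card ↔ A.card = B.card := by omega
  unfold pathSum
  simp only [hcard]
  split_ifs with hAB
  swap
  · simp
  -- Since no step leaves `x`, a path through `x` ends there, which is impossible once `x` is
  -- removed from the destinations.
  have hlast : ∀ p : List (ℕ × ℕ), (∀ z ∈ p, z ∈ entries r π) → p.IsChain (StepAvoid r π e) →
      x ∈ p → p.getLast? = some x := by
    intro p hp hp' hxp
    obtain ⟨s, t, rfl⟩ := List.append_of_mem hxp
    rcases t with _ | ⟨y, t⟩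
    · simp
    · exact absurd (List.isChain_cons_cons.1 hp'.right_of_append).1 (hx y (hp y (by simp)))
  have hout : ∀ P, IsFamily r π e (A.erase x) (B.erase x) P → ∀ p ∈ P, x ∉ p := by
    intro P hP p hp hxp
    obtain ⟨-, b, hb, hpb⟩ := hP.conn p hp
    rw [hlast p (hP.mem p hp) (hP.chain p hp) hxp, Option.some.injEq] at hpb
    simp [← hpb] at hb
  rw [Finset.mul_sum]
  symm
  refine Finset.sum_bij' (fun P _ => insert [x] P) (fun P _ => P.erase [x]) ?_ ?_ ?_ ?_ ?_
  · intro P hP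
    rw [mem_families] at hP ⊢
    have hn : [x] ∉ P := fun h => hout P hP _ h (by simp)
    refine ⟨?_, ?_, ?_, ?_, ?_⟩
    · rw [Finset.card_insert_of_notMem hn, hP.card, hA]
    · simp only [Finset.forall_mem_insert]
      exact ⟨by simpa using hxe, hP.mem⟩
    · simp only [Finset.forall_mem_insert]
      exact ⟨by simp, hP.chain⟩
    · simp only [Finset.forall_mem_insert]
      refine ⟨⟨⟨x, hxA, rfl⟩, x, hxB, rfl⟩, fun p hp => ?_⟩
      obtain ⟨⟨a, ha, hpa⟩, b, hb, hpb⟩ := hP.conn p hp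
      exact ⟨⟨a, Finset.mem_of_mem_erase ha, hpa⟩, b, Finset.mem_of_mem_erase hb, hpb⟩
    · intro p hp q hq z hz hz'
      rcases Finset.mem_insert.1 hp with rfl | hp <;> rcases Finset.mem_insert.1 hq with rfl | hq
      · rfl
      · rw [List.mem_singleton] at hz
        exact absurd (hz ▸ hz') (hout P hP q hq)
      · rw [List.mem_singleton] at hz'
        exact absurd (hz' ▸ hz) (hout P hP p hp)
      · exact hP.disj p hp q hq z hz hz'
  · intro P hP
    rw [mem_families] at hP ⊢
    obtain ⟨p, hp, hpx⟩ := hP.exists_head hxA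
    have hpx' : p = [x] := by
      obtain ⟨t, rfl⟩ := List.head?_eq_some_iff.1 hpx
      rcases t with _ | ⟨y, t⟩
      · rfl
      · exact absurd (List.isChain_cons_cons.1 (hP.chain _ hp)).1
          (hx y (hP.mem _ hp y (by simp)))
    subst hpx'
    have hsub : ∀ q ∈ P.erase [x], q ∈ P := fun q hq => Finset.mem_of_mem_erase hq
    have hq' : ∀ q ∈ P.erase [x], x ∉ q := fun q hq hxq =>
      (Finset.mem_erase.1 hq).1 (hP.eq_of_head hp (hsub q hq) hpx hxq).symm
    refine ⟨?_, fun q hq => hP.mem q (hsub q hq), fun q hq => hP.chain q (hsub q hq), ?_,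
      fun q hq q' hq' => hP.disj q (hsub q hq) q' (hsub q' hq')⟩
    · rw [Finset.card_erase_of_mem hp, hP.card, Finset.card_erase_of_mem hxA]
    · intro q hq
      obtain ⟨⟨a, ha, hqa⟩, b, hb, hqb⟩ := hP.conn q (hsub q hq)
      refine ⟨⟨a, Finset.mem_erase.2 ⟨?_, ha⟩, hqa⟩, b, Finset.mem_erase.2 ⟨?_, hb⟩, hqb⟩
      · rintro rfl
        exact hq' q hq (List.mem_of_head? hqa)
      · rintro rfl
        exact hq' q hq (List.mem_of_getLast? hqb)
  · intro P hP
    rw [mem_families] at hP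
    exact Finset.erase_insert fun h => hout P hP _ h (by simp)
  · intro P hP
    rw [mem_families] at hP
    obtain ⟨p, hp, hpx⟩ := hP.exists_head hxA
    refine Finset.insert_erase ?_
    obtain ⟨t, rfl⟩ := List.head?_eq_some_iff.1 hpx
    rcases t with _ | ⟨y, t⟩
    · exact hp
    · exact absurd (List.isChain_cons_cons.1 (hP.chain _ hp)).1
        (hx y (hP.mem _ hp y (by simp)))
  · intro P hP
    rw [mem_families] at hP
    unfold weight
    rw [Finset.prod_insert fun h => hout P hP _ h (by simp)]
    simp

theorem pathSum_empty {F : Type*} [Field F] (v : ℕ → ℕ → F) :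
    pathSum r π v e ∅ ∅ = 1 := by
  have : families r π e ∅ ∅ = {∅} := by
    ext P
    rw [mem_families, Finset.mem_singleton]
    constructor
    · intro h
      exact Finset.card_eq_zero.1 h.card
    · rintro rfl
      exact ⟨rfl, by simp, by simp, by simp, by simp⟩
  simp [pathSum, this, weight]

theorem IsFamily.le {A B : Finset (ℕ × ℕ)} {P : Finset (List (ℕ × ℕ))}
    (h : IsFamily r π e A B P) {p : List (ℕ × ℕ)} (hp : p ∈ P) {a b : ℕ × ℕ}
    (ha : p.head? = some a) (hb : p.getLast? = some b) : b.1 ≤ a.1 ∧ b.2 ≤ a.2 :=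
  le_of_mem_path (h.chain p hp) ha (List.mem_of_getLast? hb)

theorem pathSum_eq_zero_of_row {F : Type*} [Field F] (v : ℕ → ℕ → F) {A B : Finset (ℕ × ℕ)}
    {b : ℕ × ℕ} (hb : b ∈ B) (h : ∀ a ∈ A, a.1 < b.1) : pathSum r π v e A B = 0 := by
  unfold pathSum
  split_ifs with hAB
  · refine Finset.sum_eq_zero fun P hP => ?_
    rw [mem_families] at hP
    obtain ⟨p, hp, hpb⟩ := hP.exists_getLast hAB hb
    obtain ⟨⟨a, ha, hpa⟩, -⟩ := hP.conn p hp
    exact absurd (hP.le hp hpa hpb).1 (by have := h a ha; omega)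
  · rfl

theorem pathSum_eq_zero_of_col {F : Type*} [Field F] (v : ℕ → ℕ → F) {A B : Finset (ℕ × ℕ)}
    {a : ℕ × ℕ} (ha : a ∈ A) (h : ∀ b ∈ B, a.2 < b.2) : pathSum r π v e A B = 0 := by
  unfold pathSum
  split_ifs with hAB
  · refine Finset.sum_eq_zero fun P hP => ?_
    rw [mem_families] at hP
    obtain ⟨p, hp, hpa⟩ := hP.exists_head ha
    obtain ⟨-, b, hb, hpb⟩ := hP.conn p hp
    exact absurd (hP.le hp hpa hpb).2 (by have := h b hb; omega)
  · rfl

end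

/-! ### The collections `P` and `P_L` as families with `e = 0` and `e = r`. -/

section

variable {r : ℕ} {π : Equiv.Perm ℕ} {e : ℕ}

theorem isChain_stepAvoid_of_forall_ne {l : List (ℕ × ℕ)} (h : l.IsChain (Step r π))
    (he : ∀ x ∈ l, x.2 ≠ e) : l.IsChain (StepAvoid r π e) :=
  h.imp_of_mem_imp fun x _ hx _ h => h.imp id fun h => ⟨h, he x hx⟩

theorem isChain_stepAvoid_zero {l : List (ℕ × ℕ)} (hl : ∀ x ∈ l, x ∈ entries r π) :
    l.IsChain (Step r π) ↔ l.IsChain (StepAvoid r π 0) := by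
  refine ⟨fun h => isChain_stepAvoid_of_forall_ne h fun x hx => ?_,
    fun h => h.imp fun _ _ h => h.step⟩
  have := le_of_mem_entries (k := x.1) (c := x.2) (hl x hx)
  omega

/-- A path that leaves the last column never returns to it. So a condition on the first step alone
already excludes every upward step in column `r`. -/
theorem isChain_stepAvoid_last {l : List (ℕ × ℕ)} (hl : ∀ x ∈ l, x ∈ entries r π) :
    (l.IsChain (Step r π) ∧ StartsLeft r l) ↔ l.IsChain (StepAvoid r π r) := by
  match l with
  | [] => simp [StartsLeft]
  | [x] => simp [StartsLeft]
  | x :: y :: t =>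
    have hx := le_of_mem_entries (k := x.1) (c := x.2) (hl x (by simp))
    simp only [StartsLeft]
    rw [List.isChain_cons_cons, List.isChain_cons_cons]
    constructor
    · rintro ⟨⟨h1, h2⟩, h3⟩
      have h4 : (y :: t).IsChain (StepAvoid r π 0) :=
        (isChain_stepAvoid_zero fun z hz => hl z (List.mem_cons_of_mem _ hz)).1 h2
      have hxy : StepAvoid r π r x y := by
        rcases h1 with h1 | h1
        · exact Or.inl h1
        · refine Or.inr ⟨h1, fun hxr => ?_⟩
          have h5 := (h3 hxr).2
          rw [h1.1] at h5
          exact lt_irrefl _ h5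
      have hy : y.2 < r := by
        rcases hxy with h5 | h5
        · exact lt_of_lt_of_le h5.2.1 hx.2
        · rw [h5.1.1]
          exact lt_of_le_of_ne hx.2 h5.2
      exact ⟨hxy, isChain_stepAvoid_of_forall_ne h2 fun z hz =>
        ne_of_lt (lt_of_le_of_lt (le_of_mem_path h4 (by rfl) hz).2 hy)⟩
    · rintro ⟨h1, h2⟩
      refine ⟨⟨h1.step, h2.imp fun _ _ h => h.step⟩, fun hxr => ?_⟩
      rcases h1 with h1 | h1
      · exact ⟨h1.1, h1.2.1⟩
      · exact absurd hxr h1.2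

theorem isFamily_iff {A B : Finset (ℕ × ℕ)} {P : Finset (List (ℕ × ℕ))} :
    IsFamily r π e A B P ↔
      P ∈ pathSets r π A B ∧ ∀ p ∈ P, p.IsChain (StepAvoid r π e) := by
  simp only [pathSets, Finset.mem_filter, Finset.mem_powersetCard]
  constructor
  · intro h
    refine ⟨⟨⟨?_, h.card⟩, h.conn, fun p hp q hq hne x hx hx' => hne (h.disj p hp q hq x hx hx')⟩,
      h.chain⟩
    have := mem_families.2 h
    simp only [families, Finset.mem_filter, Finset.mem_powerset] at this
    exact this.1
  · rintro ⟨⟨⟨h1, h2⟩, h3, h4⟩, h5⟩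
    refine ⟨h2, fun p hp => ((mem_paths r π p).1 (h1 hp)).2.1, h5, h3, fun p hp q hq x hx hx' => ?_⟩
    by_contra hne
    exact h4 p hp q hq hne x hx hx'

theorem isPath_of_mem_pathSets {A B : Finset (ℕ × ℕ)} {P : Finset (List (ℕ × ℕ))}
    (hP : P ∈ pathSets r π A B) {p : List (ℕ × ℕ)} (hp : p ∈ P) : IsPath r π p := by
  simp only [pathSets, Finset.mem_filter, Finset.mem_powersetCard] at hP
  exact (mem_paths r π p).1 (hP.1.1 hp)

theorem pathSets_eq_families (A B : Finset (ℕ × ℕ)) :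
    pathSets r π A B = families r π 0 A B := by
  ext P
  rw [mem_families, isFamily_iff, iff_self_and]
  intro hP p hp
  have := isPath_of_mem_pathSets hP hp
  exact (isChain_stepAvoid_zero this.2.1).1 this.2.2

theorem pathSetsL_eq_families (A B : Finset (ℕ × ℕ)) :
    pathSetsL r π A B = families r π r A B := by
  ext P
  rw [mem_families, isFamily_iff, pathSetsL, Finset.mem_filter]
  refine and_congr_right fun hP => forall₂_congr fun p hp => ?_
  have := isPath_of_mem_pathSets hP hp
  rw [← isChain_stepAvoid_last this.2.1, and_iff_right this.2.2]

end

/-! ### Origins and destinations, built up row by row. -/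

/-- The ones in the columns from `b` on and the rows from `π⁻¹ b` to `k`. -/
def destUpTo (π : Equiv.Perm ℕ) (b k : ℕ) : Finset (ℕ × ℕ) :=
  ((Finset.Icc (π.symm b) k).filter fun l => b ≤ π l).image fun l => (l, π l)

/-- The rightmost entries of the rows below `π⁻¹ b` up to the row `k` that contain an element of
`destUpTo π b k`. -/
def origUpTo (r : ℕ) (π : Equiv.Perm ℕ) (b k : ℕ) : Finset (ℕ × ℕ) :=
  ((Finset.Ioc (π.symm b) k).filter fun l => b ≤ π l).image fun l => (l, rightCol r π l)

section

variable {r : ℕ} {π : Equiv.Perm ℕ} {b k : ℕ}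

theorem mem_destUpTo {l c : ℕ} :
    (l, c) ∈ destUpTo π b k ↔ π.symm b ≤ l ∧ l ≤ k ∧ b ≤ c ∧ c = π l := by
  simp only [destUpTo, Finset.mem_image, Finset.mem_filter, Finset.mem_Icc, Prod.mk.injEq]
  constructor
  · rintro ⟨l, h, rfl, rfl⟩
    tauto
  · rintro ⟨h1, h2, h3, rfl⟩
    exact ⟨l, ⟨⟨h1, h2⟩, h3⟩, rfl, rfl⟩

theorem mem_origUpTo {l c : ℕ} :
    (l, c) ∈ origUpTo r π b k ↔ π.symm b < l ∧ l ≤ k ∧ b ≤ π l ∧ c = rightCol r π l := by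
  simp only [origUpTo, Finset.mem_image, Finset.mem_filter, Finset.mem_Ioc, Prod.mk.injEq]
  constructor
  · rintro ⟨l, h, rfl, rfl⟩
    tauto
  · rintro ⟨h1, h2, h3, rfl⟩
    exact ⟨l, ⟨⟨h1, h2⟩, h3⟩, rfl, rfl⟩

theorem destUpTo_succ_of_lt (h : π (k + 1) < b) : destUpTo π b (k + 1) = destUpTo π b k := by
  ext ⟨l, c⟩
  rw [mem_destUpTo, mem_destUpTo]
  constructor
  · rintro ⟨h1, h2, h3, rfl⟩
    have : l ≠ k + 1 := by rintro rfl; omega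
    omega
  · rintro ⟨h1, h2, h3, h4⟩
    omega

theorem origUpTo_succ_of_lt (h : π (k + 1) < b) : origUpTo r π b (k + 1) = origUpTo r π b k := by
  ext ⟨l, c⟩
  rw [mem_origUpTo, mem_origUpTo]
  constructor
  · rintro ⟨h1, h2, h3, rfl⟩
    have : l ≠ k + 1 := by rintro rfl; omega
    omega
  · rintro ⟨h1, h2, h3, h4⟩
    omega

theorem destUpTo_succ_of_le (h : b ≤ π (k + 1)) (hk : π.symm b ≤ k + 1) :
    destUpTo π b (k + 1) = insert (k + 1, π (k + 1)) (destUpTo π b k) := by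
  ext ⟨l, c⟩
  rw [Finset.mem_insert, mem_destUpTo, mem_destUpTo, Prod.mk.injEq]
  constructor
  · rintro ⟨h1, h2, h3, rfl⟩
    by_cases h4 : l = k + 1
    · subst h4
      exact Or.inl ⟨rfl, rfl⟩
    · exact Or.inr ⟨h1, by omega, h3, rfl⟩
  · rintro (⟨rfl, rfl⟩ | ⟨h1, h2, h3, h4⟩)
    · exact ⟨hk, le_rfl, h, rfl⟩
    · exact ⟨h1, by omega, h3, h4⟩

theorem origUpTo_succ_of_le (h : b ≤ π (k + 1)) (hk : π.symm b ≤ k) :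
    origUpTo r π b (k + 1) = insert (k + 1, rightCol r π (k + 1)) (origUpTo r π b k) := by
  ext ⟨l, c⟩
  rw [Finset.mem_insert, mem_origUpTo, mem_origUpTo, Prod.mk.injEq]
  constructor
  · rintro ⟨h1, h2, h3, rfl⟩
    by_cases h4 : l = k + 1
    · subst h4
      exact Or.inl ⟨rfl, rfl⟩
    · exact Or.inr ⟨h1, by omega, h3, rfl⟩
  · rintro (⟨rfl, rfl⟩ | ⟨h1, h2, h3, h4⟩)
    · exact ⟨by omega, le_rfl, h, rfl⟩
    · exact ⟨h1, by omega, h3, h4⟩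

theorem destUpTo_eq_empty (hk : k < π.symm b) : destUpTo π b k = ∅ := by
  ext ⟨l, c⟩
  rw [mem_destUpTo]
  simp only [Finset.notMem_empty, iff_false]
  omega

theorem destUpTo_symm : destUpTo π b (π.symm b) = {(π.symm b, b)} := by
  ext ⟨l, c⟩
  rw [mem_destUpTo, Finset.mem_singleton, Prod.mk.injEq]
  constructor
  · rintro ⟨h1, h2, h3, rfl⟩
    obtain rfl : l = π.symm b := le_antisymm h2 h1
    simp
  · rintro ⟨rfl, rfl⟩
    simp

theorem origUpTo_symm : origUpTo r π b (π.symm b) = ∅ := by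
  ext ⟨l, c⟩
  rw [mem_origUpTo]
  simp only [Finset.notMem_empty, iff_false]
  omega

/-- The surplus destination is `1_b`, whose row supplies no origin; it is balanced by the origin of
the distinguished path. -/
theorem card_destUpTo (hk : π.symm b ≤ k) :
    (destUpTo π b k).card = (origUpTo r π b k).card + 1 := by
  induction k, hk using Nat.le_induction with
  | base => rw [destUpTo_symm, origUpTo_symm]; rfl
  | succ k hk ih =>
    rcases lt_or_ge (π (k + 1)) b with h | h
    · rw [destUpTo_succ_of_lt h, origUpTo_succ_of_lt h, ih]
    · rw [destUpTo_succ_of_le h (by omega), origUpTo_succ_of_le h hk,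
        Finset.card_insert_of_notMem, Finset.card_insert_of_notMem, ih]
      · rw [mem_origUpTo]; omega
      · rw [mem_destUpTo]; omega

theorem dest_eq (hπ : FixesOutside r π) {a b : ℕ} (h : (a, b) ∈ invSet r π) :
    dest r π a b = destUpTo π b (π.symm a) := by
  rw [mem_invSet_iff] at h
  have ha := (mem_Icc_perm_symm hπ a).2 (by omega)
  have hb := (mem_Icc_perm_symm hπ b).2 (by omega)
  ext ⟨l, c⟩
  rw [mem_destUpTo]
  simp only [dest, block, Finset.mem_filter]
  constructor
  · rintro ⟨⟨-, h1, h2, h3⟩, h4⟩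
    exact ⟨h1, h2, h3, h4⟩
  · rintro ⟨h1, h2, h3, rfl⟩
    exact ⟨⟨perm_mem_entries hπ (by omega) (by omega), h1, h2, h3⟩, rfl⟩

theorem orig_eq (hπ : FixesOutside r π) {a b : ℕ} (h : (a, b) ∈ invSet r π) :
    orig r π a b = insert (π.symm a, rightCol r π (π.symm a)) (origUpTo r π b (π.symm a)) := by
  have h0 := (mem_invSet_iff a b).1 h
  have ha := (mem_Icc_perm_symm hπ a).2 (by omega)
  have hb := (mem_Icc_perm_symm hπ b).2 (by omega)
  have hab : (π.symm a, b) ∈ entries r π := by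
    rw [mem_entries_iff hπ, Equiv.apply_symm_apply]
    omega
  have hmax : ∀ l c, (l, c) ∈ block r π a b →
      ((∀ q ∈ block r π a b, q.1 = l → q.2 ≤ c) ↔ c = rightCol r π l) := by
    intro l c hlc
    simp only [block, Finset.mem_filter] at hlc
    constructor
    · intro hq
      refine le_antisymm (le_rightCol hlc.1) ?_
      refine hq (l, rightCol r π l) ?_ rfl
      simp only [block, Finset.mem_filter]
      exact ⟨rightCol_spec hπ (by omega) (by omega), hlc.2.1, hlc.2.2.1,
        hlc.2.2.2.trans (le_rightCol hlc.1)⟩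
    · rintro rfl ⟨q1, q2⟩ hq rfl
      simp only [block, Finset.mem_filter] at hq
      exact le_rightCol hq.1
  ext ⟨l, c⟩
  rw [orig, Finset.mem_filter, Finset.mem_insert, mem_origUpTo, Prod.mk.injEq]
  constructor
  · rintro ⟨h1, h2, h3⟩
    have h4 := (hmax l c h1).1 h2
    subst h4
    rcases h3 with rfl | ⟨⟨d1, d2⟩, hd, hne, rfl⟩
    · exact Or.inl ⟨rfl, rfl⟩
    · rw [dest_eq hπ h, mem_destUpTo] at hd
      obtain ⟨hd1, hd2, hd3, rfl⟩ := hd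
      refine Or.inr ⟨lt_of_le_of_ne hd1 ?_, hd2, hd3, rfl⟩
      rintro rfl
      exact hne (by simp)
  · rintro (⟨rfl, rfl⟩ | ⟨h1, h2, h3, rfl⟩)
    · have hm : (π.symm a, rightCol r π (π.symm a)) ∈ block r π a b := by
        simp only [block, Finset.mem_filter]
        exact ⟨rightCol_spec hπ ha.1 ha.2, by omega, le_rfl, le_rightCol hab⟩
      exact ⟨hm, (hmax _ _ hm).2 rfl, Or.inl rfl⟩
    · have hm : (l, rightCol r π l) ∈ block r π a b := by
        simp only [block, Finset.mem_filter]
        exact ⟨rightCol_spec hπ (by omega) (by omega), h1.le, h2,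
          h3.trans (le_rightCol (perm_mem_entries hπ (by omega) (by omega)))⟩
      refine ⟨hm, (hmax _ _ hm).2 rfl, Or.inr ⟨(l, π l), ?_, ?_, rfl⟩⟩
      · rw [dest_eq hπ h, mem_destUpTo]
        exact ⟨h1.le, h2, h3, rfl⟩
      · rw [Ne, Prod.mk.injEq]
        omega

end

/-! ### Path sums with one or two origins in the bottom row. -/

/-- The product of the entries of row `k` up to the column `c`. -/
noncomputable def rowProd {F : Type*} [Field F] (r : ℕ) (π : Equiv.Perm ℕ) (v : ℕ → ℕ → F)
    (k c : ℕ) : F :=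
  ∏ j ∈ (Finset.range (c + 1)).filter fun j => (k, j) ∈ entries r π, wn r π v k j

section

variable {F : Type*} [Field F] {r : ℕ} {π : Equiv.Perm ℕ} {v : ℕ → ℕ → F} {e : ℕ}

theorem rowProd_perm (hπ : FixesOutside r π) {k : ℕ} (h1 : 1 ≤ k) (h2 : k ≤ r) :
    rowProd r π v k (π k) = 1 := by
  have : (Finset.range (π k + 1)).filter (fun j => (k, j) ∈ entries r π) = {π k} := by
    ext j
    rw [Finset.mem_filter, Finset.mem_range, Finset.mem_singleton]
    constructor
    · rintro ⟨h3, h4⟩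
      rw [mem_entries_iff hπ] at h4
      omega
    · rintro rfl
      exact ⟨by omega, perm_mem_entries hπ h1 h2⟩
  rw [rowProd, this, Finset.prod_singleton, wn_perm]

theorem rowProd_leftCol (hπ : FixesOutside r π) {k c : ℕ} (h : (k, c) ∈ entries r π)
    (hc : π k < c) : rowProd r π v k c = wn r π v k c * rowProd r π v k (leftCol r π k c) := by
  have h' := (mem_entries_iff hπ k c).1 h
  obtain ⟨h3, h4⟩ := leftCol_spec hπ h'.1 h'.2.1 hc
  have : (Finset.range (c + 1)).filter (fun j => (k, j) ∈ entries r π) =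
      insert c ((Finset.range (leftCol r π k c + 1)).filter fun j => (k, j) ∈ entries r π) := by
    ext j
    rw [Finset.mem_insert, Finset.mem_filter, Finset.mem_range, Finset.mem_filter, Finset.mem_range]
    constructor
    · rintro ⟨h5, h6⟩
      rcases Nat.lt_succ_iff_lt_or_eq.1 h5 with h5 | h5
      · exact Or.inr ⟨Nat.lt_succ_of_le (le_leftCol h6 h5), h6⟩
      · exact Or.inl h5
    · rintro (rfl | ⟨h5, h6⟩)
      · exact ⟨by omega, h⟩
      · exact ⟨by omega, h6⟩
  rw [rowProd, this, Finset.prod_insert, rowProd]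
  rw [Finset.mem_filter, Finset.mem_range]
  omega

theorem rowProd_rightCol (k : ℕ) :
    rowProd r π v k (rightCol r π k) = rho r π v k := by
  rw [rowProd, rho]
  refine Finset.prod_bij (fun j _ => (k, j)) ?_ ?_ ?_ ?_
  · intro j hj
    simp only [Finset.mem_filter] at hj ⊢
    exact ⟨hj.2, trivial⟩
  · intro i _ j _ h
    exact (Prod.mk.inj h).2
  · rintro ⟨l, j⟩ h
    simp only [Finset.mem_filter] at h
    obtain ⟨h, rfl⟩ := h
    exact ⟨j, by simp only [Finset.mem_filter, Finset.mem_range]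
                 exact ⟨Nat.lt_succ_of_le (le_rightCol h), h⟩, rfl⟩
  · intro j _
    rfl

theorem rho_ne_zero (hv : ∀ p ∈ invSet r π, v p.1 p.2 ≠ 0) (k : ℕ) : rho r π v k ≠ 0 := by
  rw [rho, Finset.prod_ne_zero_iff]
  intro p hp
  exact wn_ne_zero hv (Finset.mem_filter.1 hp).1

/-- A one is the leftmost entry of its row and the topmost entry of its column. -/
theorem not_stepAvoid_perm (hπ : FixesOutside r π) {k : ℕ} (y : ℕ × ℕ)
    (hy : y ∈ entries r π) : ¬ StepAvoid r π e (k, π k) y := by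
  obtain ⟨y1, y2⟩ := y
  rw [mem_entries_iff hπ] at hy
  rintro (⟨h1, h2, -⟩ | ⟨⟨h1, h2, -⟩, -⟩)
  · simp only at h1 h2
    subst h1
    omega
  · simp only at h1 h2
    subst h1
    rw [Equiv.symm_apply_apply] at hy
    omega

/-- One step of the rightmost path in the bottom row. -/
theorem pathSum_insert (hπ : FixesOutside r π) {k c : ℕ} (h : (k, c) ∈ entries r π) (hc : π k < c)
    {Q B : Finset (ℕ × ℕ)} (hQ : ∀ q ∈ Q, q.1 < k ∨ (q.1 = k ∧ q.2 < c)) (hB : (k, c) ∉ B)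
    (hcard : Q.card + 1 ≤ B.card) :
    pathSum r π v e (insert (k, c) Q) B = wn r π v k c *
      (pathSum r π v e (insert (k, leftCol r π k c) Q) B +
        if c = e then 0 else pathSum r π v e (insert (lowRow r π (k - 1) c, c) Q) B) := by
  classical
  have h' := (mem_entries_iff hπ k c).1 h
  have hcr := le_of_mem_entries h
  have hup : π.symm c < k := by
    refine lt_of_le_of_ne h'.2.2.2 ?_
    rw [Ne, Equiv.symm_apply_eq]
    omega
  have hxQ : (k, c) ∉ Q := fun hx => by
    have := hQ _ hx
    simp only at this
    omega
  -- The inequality is allowed because `Q` may shrink when a new origin coincides with an old one.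
  -- In the strict case every path sum involved is 0 for lack of origins.
  rcases hcard.eq_or_lt with hcard | hcard
  · rw [pathSum_step (x := (k, c)) v _ (Finset.mem_insert_self _ _) hB _ h,
      Finset.erase_insert hxQ]
    · congr 1
      by_cases hce : c = e
      · have : (entries r π).filter (StepAvoid r π e (k, c)) = {(k, leftCol r π k c)} := by
          ext q
          rw [Finset.mem_filter, Finset.mem_singleton, ← leftStep_iff hπ h'.1 h'.2.1 hc]
          refine and_congr_right fun _ => ⟨fun hq => ?_, Or.inl⟩
          exact hq.resolve_right fun hq => hq.2 hce
        rw [this, Finset.sum_singleton, if_pos hce, add_zero]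
      · have : (entries r π).filter (StepAvoid r π e (k, c)) =
            {(k, leftCol r π k c), (lowRow r π (k - 1) c, c)} := by
          ext q
          rw [Finset.mem_filter, Finset.mem_insert, Finset.mem_singleton,
            ← leftStep_iff hπ h'.1 h'.2.1 hc, ← upStep_iff hπ hcr.1 hcr.2 hup, ← and_or_left]
          refine and_congr_right fun _ => ⟨fun hq => ?_, fun hq => ?_⟩
          · exact hq.imp id And.left
          · exact hq.imp id fun hq => ⟨hq, hce⟩
        rw [this, Finset.sum_pair, if_neg hce]
        rw [Ne, Prod.mk.injEq]
        have := (leftCol_spec hπ h'.1 h'.2.1 hc).2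
        omega
    · rw [Finset.card_insert_of_notMem hxQ, hcard]
    · rintro a ha h1 h2
      rcases Finset.mem_insert.1 ha with rfl | ha
      · rfl
      · have := hQ a ha
        simp only at h1 h2
        omega
  · have key : ∀ x, pathSum r π v e (insert x Q) B = 0 := fun x => by
      rw [pathSum, if_neg]
      have := Finset.card_insert_le x Q
      omega
    simp [key]

/-- A path that has to end in its row. -/
theorem pathSum_insert_row (hπ : FixesOutside r π) {k c : ℕ} (h : (k, c) ∈ entries r π)
    {Q B : Finset (ℕ × ℕ)} (hQ : ∀ q ∈ Q, q.1 < k) (hB : ∀ q ∈ B, q.1 < k)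
    (hcard : Q.card ≤ B.card) :
    pathSum r π v e (insert (k, c) Q) (insert (k, π k) B) =
      rowProd r π v k c * pathSum r π v e Q B := by
  have h' := (mem_entries_iff hπ k c).1 h
  have hkB : ∀ c, (k, c) ∉ B := fun c hx => lt_irrefl _ (hB _ hx)
  have hkQ : ∀ c, (k, c) ∉ Q := fun c hx => lt_irrefl _ (hQ _ hx)
  induction c using Nat.strong_induction_on with
  | _ c ih =>
    rcases h'.2.2.1.lt_or_eq with hc | rfl
    · have h1 := leftCol_spec hπ h'.1 h'.2.1 hc
      rw [pathSum_insert hπ h hc (fun q hq => Or.inl (hQ q hq)) _ _,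
        ih _ h1.2 h1.1 ((mem_entries_iff hπ _ _).1 h1.1), rowProd_leftCol hπ h hc,
        pathSum_eq_zero_of_row (A := insert (lowRow r π (k - 1) c, c) Q) v
          (Finset.mem_insert_self (k, π k) B)]
      · simp [mul_assoc]
      · simp only [Finset.mem_insert, forall_eq_or_imp]
        refine ⟨?_, hQ⟩
        have hcr := le_of_mem_entries h
        have hup : π.symm c < k := by
          refine lt_of_le_of_ne h'.2.2.2 ?_
          rw [Ne, Equiv.symm_apply_eq]
          omega
        have := (lowRow_spec hπ (k := k - 1) hcr.1 hcr.2 (by omega)).2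
        omega
      · rw [Finset.mem_insert, Prod.mk.injEq, not_or]
        exact ⟨by omega, hkB c⟩
      · rw [Finset.card_insert_of_notMem (hkB _)]
        omega
    · rw [pathSum_absorb v (Finset.mem_insert_self _ _) (Finset.mem_insert_self _ _) h
        (not_stepAvoid_perm hπ), Finset.erase_insert (hkQ _), Finset.erase_insert (hkB _), wn_perm,
        rowProd_perm hπ h'.1 h'.2.1]

/-- Two paths in the bottom row, one of which has to end there. -/
theorem pathSum_insert_insert (hπ : FixesOutside r π) {k c c' : ℕ} (h : (k, c) ∈ entries r π)
    (h' : (k, c') ∈ entries r π) (hcc : c < c')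
    {Q B : Finset (ℕ × ℕ)} (hQ : ∀ q ∈ Q, q.1 < k) (hB : ∀ q ∈ B, q.1 < k)
    (hcard : Q.card + 1 = B.card) :
    pathSum r π v e (insert (k, c') (insert (k, c) Q)) (insert (k, π k) B) =
      wn r π v k c' *
        (pathSum r π v e (insert (k, leftCol r π k c') (insert (k, c) Q)) (insert (k, π k) B) +
          if c' = e then 0 else rowProd r π v k c *
            pathSum r π v e (insert (lowRow r π (k - 1) c', c') Q) B) := by
  have h1 := (mem_entries_iff hπ k c).1 h
  have h2 := (mem_entries_iff hπ k c').1 h'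
  have hkB : ∀ c, (k, c) ∉ B := fun c hx => lt_irrefl _ (hB _ hx)
  have hkQ : ∀ c, (k, c) ∉ Q := fun c hx => lt_irrefl _ (hQ _ hx)
  rw [pathSum_insert hπ h' (by omega), Finset.insert_comm (lowRow r π (k - 1) c', c'),
    pathSum_insert_row hπ h _ hB]
  · refine (Finset.card_insert_le _ _).trans hcard.le
  · simp only [Finset.mem_insert, forall_eq_or_imp]
    refine ⟨?_, hQ⟩
    have hcr := le_of_mem_entries h'
    have hup : π.symm c' < k := by
      refine lt_of_le_of_ne h2.2.2.2 ?_
      rw [Ne, Equiv.symm_apply_eq]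
      omega
    have := (lowRow_spec hπ (k := k - 1) hcr.1 hcr.2 (by omega)).2
    omega
  · simp only [Finset.mem_insert, forall_eq_or_imp]
    exact ⟨Or.inr ⟨trivial, hcc⟩, fun q hq => Or.inl (hQ q hq)⟩
  · rw [Finset.mem_insert, Prod.mk.injEq, not_or]
    exact ⟨by omega, hkB c'⟩
  · rw [Finset.card_insert_of_notMem (hkB _), Finset.card_insert_of_notMem (hkQ _)]
    omega

theorem pathSum_insert_insert_self {k c : ℕ} {Q B : Finset (ℕ × ℕ)} (hQ : ∀ q ∈ Q, q.1 < k)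
    (hB : ∀ q ∈ B, q.1 < k) (hcard : Q.card + 1 = B.card) :
    pathSum r π v e (insert (k, c) (insert (k, c) Q)) (insert (k, π k) B) = 0 := by
  have hkB : ∀ c, (k, c) ∉ B := fun c hx => lt_irrefl _ (hB _ hx)
  have hkQ : ∀ c, (k, c) ∉ Q := fun c hx => lt_irrefl _ (hQ _ hx)
  rw [Finset.insert_idem, pathSum, if_neg]
  rw [Finset.card_insert_of_notMem (hkB _), Finset.card_insert_of_notMem (hkQ _)]
  omega

/-- Some path must end at the one of row `k`. With origins `c ≤ c'`, the left path has to go left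
from `c`, since going up would leave the right path blocked at `c`. Hence moving its origin to the
left neighbour gains only the families in which the right path runs to `c` and then turns up; there
the two paths together use the row up to `c'`, which gives `rowProd`. The induction on `c'` moves
the right origin towards `c`. -/
theorem pathSum_insert_insert_leftCol (hπ : FixesOutside r π) {k c c' : ℕ}
    (h : (k, c) ∈ entries r π) (h' : (k, c') ∈ entries r π) (hc : π k < c) (hcc : c ≤ c')
    {Q B : Finset (ℕ × ℕ)} (hQ : ∀ q ∈ Q, q.1 < k) (hB : ∀ q ∈ B, q.1 < k)
    (hcard : Q.card + 1 = B.card) :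
    wn r π v k c * pathSum r π v e (insert (k, c') (insert (k, leftCol r π k c) Q))
        (insert (k, π k) B) =
      pathSum r π v e (insert (k, c') (insert (k, c) Q)) (insert (k, π k) B) +
        if c = e then 0 else wn r π v k c * rowProd r π v k c' *
          pathSum r π v e (insert (lowRow r π (k - 1) c, c) Q) B := by
  have h1 := (mem_entries_iff hπ k c).1 h
  have h3 := leftCol_spec hπ h1.1 h1.2.1 hc
  induction c' using Nat.strong_induction_on with
  | _ c' ih =>
    rw [pathSum_insert_insert hπ h3.1 h' (by omega) hQ hB hcard]
    rcases hcc.lt_or_eq with hlt | rfl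
    · have h4 := leftCol_spec hπ h1.1 h1.2.1 (hc.trans hlt)
      have h5 := ih _ h4.2 h4.1 (le_leftCol h hlt)
      rw [pathSum_insert_insert hπ h h' hlt hQ hB hcard, rowProd_leftCol hπ h' (hc.trans hlt),
        rowProd_leftCol hπ h hc]
      generalize pathSum r π v e (insert (k, leftCol r π k c') (insert (k, leftCol r π k c) Q))
        (insert (k, π k) B) = X at h5 ⊢
      split_ifs at h5 ⊢ <;> linear_combination wn r π v k c' * h5
    · rw [pathSum_insert_insert_self hQ hB hcard, pathSum_insert_insert_self hQ hB hcard,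
        rowProd_leftCol hπ h hc]
      split_ifs <;> ring

end

/-! ### Signed sums and their recursion. -/

/-- The number of column lines that cross the row `k` strictly to the right of the column `c`. -/
def linesRight (r : ℕ) (π : Equiv.Perm ℕ) (k c : ℕ) : ℕ :=
  ((Finset.Ioc c r).filter fun j => π.symm j ≤ k).card

/-- The signed and normalised sum over the families of paths that connect the position in column `c`
just above the row `k + 1`, and the origins of `origUpTo r π b k`, to `destUpTo π b k`. -/
noncomputable def signedSum {F : Type*} [Field F] (r : ℕ) (π : Equiv.Perm ℕ) (v : ℕ → ℕ → F)
    (e b k c : ℕ) : F :=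
  if k < π.symm b then 0 else
    (-1) ^ (linesRight r π k c + (destUpTo π b k).card + 1) *
      (pathSum r π v e (insert (lowRow r π k c, c) (origUpTo r π b k)) (destUpTo π b k) /
        ∏ d ∈ destUpTo π b k, rho r π v d.1)

section

variable {F : Type*} [Field F] {r : ℕ} {π : Equiv.Perm ℕ} {v : ℕ → ℕ → F} {e b : ℕ}

theorem linesRight_succ_of_lt (hπ : FixesOutside r π) {k c : ℕ} (hk : k + 1 ≤ r)
    (hc : c < π (k + 1)) : linesRight r π (k + 1) c = linesRight r π k c + 1 := by
  have hk' := (mem_Icc_perm hπ (k + 1)).2 (by omega)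
  have : (Finset.Ioc c r).filter (fun j => π.symm j ≤ k + 1) =
      insert (π (k + 1)) ((Finset.Ioc c r).filter fun j => π.symm j ≤ k) := by
    ext j
    rw [Finset.mem_insert, Finset.mem_filter, Finset.mem_filter, Finset.mem_Ioc,
      ← Equiv.symm_apply_eq]
    constructor
    · rintro ⟨h1, h2⟩
      omega
    · rintro (h1 | ⟨h1, h2⟩)
      · rw [Equiv.symm_apply_eq] at h1
        subst h1
        rw [Equiv.symm_apply_apply]
        omega
      · omega
  rw [linesRight, this, Finset.card_insert_of_notMem, linesRight]
  rw [Finset.mem_filter, Equiv.symm_apply_apply]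
  omega

theorem linesRight_succ_of_le {k c : ℕ} (hc : π (k + 1) ≤ c) :
    linesRight r π (k + 1) c = linesRight r π k c := by
  unfold linesRight
  congr 1
  ext j
  rw [Finset.mem_filter, Finset.mem_filter, Finset.mem_Ioc]
  refine and_congr_right fun hj => ?_
  have : π.symm j ≠ k + 1 := by
    rw [Ne, Equiv.symm_apply_eq]
    omega
  omega

/-- Only the column line through `c` is gained; this is the source of the minus sign in
`signedSum_step`. -/
theorem linesRight_leftCol (hπ : FixesOutside r π) {k c : ℕ} (h : (k, c) ∈ entries r π)
    (hc : π k < c) : linesRight r π k (leftCol r π k c) = linesRight r π k c + 1 := by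
  have h' := (mem_entries_iff hπ k c).1 h
  have hcr := le_of_mem_entries h
  obtain ⟨h3, h4⟩ := leftCol_spec hπ h'.1 h'.2.1 hc
  have h5 := (mem_entries_iff hπ _ _).1 h3
  have : (Finset.Ioc (leftCol r π k c) r).filter (fun j => π.symm j ≤ k) =
      insert c ((Finset.Ioc c r).filter fun j => π.symm j ≤ k) := by
    ext j
    rw [Finset.mem_insert, Finset.mem_filter, Finset.mem_filter, Finset.mem_Ioc, Finset.mem_Ioc]
    constructor
    · rintro ⟨h6, h7⟩
      have h8 : (k, j) ∈ entries r π := (mem_entries_iff hπ k j).2 (by omega)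
      have h9 : ¬ j < c := fun hj => by
        have := le_leftCol h8 hj
        omega
      omega
    · rintro (rfl | ⟨h6, h7⟩) <;> omega
  rw [linesRight, this, Finset.card_insert_of_notMem, linesRight]
  rw [Finset.mem_filter, Finset.mem_Ioc]
  omega

theorem linesRight_rightCol (hπ : FixesOutside r π) {k : ℕ} (h1 : 1 ≤ k) (h2 : k ≤ r) :
    linesRight r π k (rightCol r π k) = 0 := by
  rw [linesRight, Finset.card_eq_zero, Finset.filter_eq_empty_iff]
  intro j hj hjk
  rw [Finset.mem_Ioc] at hj
  have h3 := (mem_entries_iff hπ _ _).1 (rightCol_spec hπ h1 h2)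
  have h4 : (k, j) ∈ entries r π := (mem_entries_iff hπ k j).2 (by omega)
  have := le_rightCol h4
  omega

theorem signedSum_eq_zero_of_lt {k c : ℕ} (hc : c < b) : signedSum r π v e b k c = 0 := by
  unfold signedSum
  split_ifs
  · rfl
  · rw [pathSum_eq_zero_of_col v (Finset.mem_insert_self _ _), zero_div, mul_zero]
    rintro ⟨l, j⟩ h
    rw [mem_destUpTo] at h
    exact lt_of_lt_of_le hc h.2.2.1

theorem row_lt_of_mem_origUpTo {k : ℕ} : ∀ q ∈ origUpTo r π b k, q.1 < k + 1 := by
  rintro ⟨l, j⟩ h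
  rw [mem_origUpTo] at h
  exact Nat.lt_succ_of_le h.2.1

theorem row_lt_of_mem_destUpTo {k : ℕ} : ∀ q ∈ destUpTo π b k, q.1 < k + 1 := by
  rintro ⟨l, j⟩ h
  rw [mem_destUpTo] at h
  exact Nat.lt_succ_of_le h.2.1

theorem notMem_destUpTo_succ {k c : ℕ} : (k + 1, c) ∉ destUpTo π b k :=
  fun h => lt_irrefl _ (row_lt_of_mem_destUpTo _ h)

/-- For `b ≤ c` and once row `π⁻¹ b` has been reached, row `k + 1` adds one destination and one
origin. Only that origin can reach the new destination, so its path fills the row and cancels the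
new `rho`. The sign changes twice: one more column line to the right, one more destination. -/
theorem signedSum_pass (hπ : FixesOutside r π) (hv : ∀ p ∈ invSet r π, v p.1 p.2 ≠ 0)
    {k c : ℕ} (hk : k + 1 ≤ r) (hc1 : 1 ≤ c) (hc : c < π (k + 1)) (hck : π.symm c ≤ k) :
    signedSum r π v e b (k + 1) c = signedSum r π v e b k c := by
  have hk' := (mem_Icc_perm hπ (k + 1)).2 (by omega)
  have hent : (k + 1, c) ∉ entries r π := by
    rw [mem_entries_iff hπ]
    omega
  rcases lt_or_ge c b with hcb | hcb
  · rw [signedSum_eq_zero_of_lt hcb, signedSum_eq_zero_of_lt hcb]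
  unfold signedSum
  have hb : k + 1 ≠ π.symm b := by
    rintro h
    rw [h, Equiv.apply_symm_apply] at hc
    omega
  by_cases h1 : k < π.symm b
  · rw [if_pos h1, if_pos (by omega)]
  rw [if_neg h1, if_neg (by omega)]
  have hlow := lowRow_spec hπ (k := k) hc1 (by omega) hck
  rw [linesRight_succ_of_lt hπ hk hc, lowRow_pred (by omega) hent, Nat.add_sub_cancel,
    destUpTo_succ_of_le (by omega) (by omega), origUpTo_succ_of_le (by omega) (by omega),
    Finset.card_insert_of_notMem notMem_destUpTo_succ,
    Finset.prod_insert notMem_destUpTo_succ, Finset.insert_comm,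
    pathSum_insert_row hπ (rightCol_spec hπ (by omega) hk) _ row_lt_of_mem_destUpTo,
    rowProd_rightCol]
  · have := rho_ne_zero hv (k + 1)
    rw [mul_div_mul_left _ _ this]
    ring
  · rw [card_destUpTo (by omega)]
    exact Finset.card_insert_le _ _
  · simp only [Finset.mem_insert, forall_eq_or_imp]
    exact ⟨by omega, row_lt_of_mem_origUpTo⟩

theorem signedSum_step (hπ : FixesOutside r π) (hv : ∀ p ∈ invSet r π, v p.1 p.2 ≠ 0)
    {k c : ℕ} (h : (k + 1, c) ∈ entries r π) (hc : π (k + 1) < c) :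
    signedSum r π v e b (k + 1) c = wn r π v (k + 1) c *
      ((if c = e then 0 else signedSum r π v e b k c) -
        signedSum r π v e b (k + 1) (leftCol r π (k + 1) c)) := by
  have h' := (mem_entries_iff hπ _ _).1 h
  have hcr := le_of_mem_entries h
  have h3 := leftCol_spec hπ h'.1 h'.2.1 hc
  unfold signedSum
  by_cases h1 : k + 1 < π.symm b
  · simp [h1, show k < π.symm b by omega]
  rw [if_neg h1, if_neg h1, lowRow_self h, lowRow_self h3.1, linesRight_leftCol hπ h hc]
  -- In the first relevant row the sole destination is `1_b`, so the path must stay in the row and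
  -- the term from above is 0.
  rcases eq_or_ne (k + 1) (π.symm b) with hb | hb
  · have hb' : π (k + 1) = b := by rw [hb, Equiv.apply_symm_apply]
    rw [if_pos (show k < π.symm b by omega), hb, origUpTo_symm, ← hb,
      destUpTo_succ_of_le hb'.ge hb.ge, destUpTo_eq_empty (by omega),
      pathSum_insert_row hπ h (by simp) (by simp) le_rfl,
      pathSum_insert_row hπ h3.1 (by simp) (by simp) le_rfl, rowProd_leftCol hπ h hc]
    simp only [ite_self]
    ring
  · have hd : π.symm b ≤ k := by omega
    rw [if_neg (show ¬ k < π.symm b by omega), linesRight_succ_of_le hc.le]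
    rcases lt_or_ge (π (k + 1)) b with h4 | h4
    · rw [destUpTo_succ_of_lt h4, origUpTo_succ_of_lt h4,
        pathSum_insert hπ h hc (fun q hq => Or.inl (row_lt_of_mem_origUpTo q hq))
          notMem_destUpTo_succ (card_destUpTo hd).ge, Nat.add_sub_cancel]
      split_ifs <;> ring
    -- Row `k + 1` now has a destination, and the second path in it starts at the right end. The
    -- extra destination flips the sign relative to row `k`, which matches the sign in `key`.
    · have key := pathSum_insert_insert_leftCol (v := v) (e := e) hπ h
        (rightCol_spec hπ (by omega) h'.2.1) hc (le_rightCol h)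
        (row_lt_of_mem_origUpTo (r := r) (b := b)) row_lt_of_mem_destUpTo (card_destUpTo hd).symm
      rw [rowProd_rightCol, Nat.add_sub_cancel] at key
      rw [destUpTo_succ_of_le h4 (by omega), origUpTo_succ_of_le h4 hd,
        Finset.card_insert_of_notMem notMem_destUpTo_succ,
        Finset.prod_insert notMem_destUpTo_succ, Finset.insert_comm (k + 1, c),
        Finset.insert_comm (k + 1, leftCol r π (k + 1) c)]
      have h5 := rho_ne_zero hv (k + 1)
      have h6 : ∏ d ∈ destUpTo π b k, rho r π v d.1 ≠ 0 :=
        Finset.prod_ne_zero_iff.2 fun d _ => rho_ne_zero hv d.1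
      simp only
      generalize ∏ d ∈ destUpTo π b k, rho r π v d.1 = D at h6 ⊢
      generalize rho r π v (k + 1) = ρ at h5 key ⊢
      generalize pathSum r π v e (insert (lowRow r π k c, c) (origUpTo r π b k))
        (destUpTo π b k) = Y at key ⊢
      generalize pathSum r π v e (insert _ (insert (k + 1, leftCol r π (k + 1) c) _)) _ = X at key ⊢
      generalize pathSum r π v e (insert _ (insert (k + 1, c) _)) _ = Z at key ⊢
      rw [eq_sub_of_add_eq key.symm]
      split_ifs
      · ring
      · field_simp
        ring

/-! ### Entries of `wu` and of the vectors `x^L` as signed sums. -/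

/-- The entries of `wu`, and the numbers `R_L`, in terms of `signedSum`. -/
theorem signedSum_rightCol_of_mem (hπ : FixesOutside r π) {k : ℕ} (h : (π k, b) ∈ invSet r π) :
    signedSum r π v e b k (rightCol r π k) =
      (-1) ^ ((dest r π (π k) b).card - 1) *
        (pathSum r π v e (orig r π (π k) b) (dest r π (π k) b) /
          ∏ d ∈ dest r π (π k) b, rho r π v d.1) := by
  have h' := (mem_invSet_iff _ _).1 h
  rw [Equiv.symm_apply_apply] at h'
  have hb := (mem_Icc_perm_symm hπ b).2 (by omega)
  have hk := (mem_Icc_perm hπ k).1 (by omega)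
  rw [signedSum, if_neg (by omega), linesRight_rightCol hπ hk.1 hk.2, dest_eq hπ h, orig_eq hπ h,
    Equiv.symm_apply_apply, lowRow_self (rightCol_spec hπ hk.1 hk.2),
    card_destUpTo (r := r) h'.2.2.2.le, Nat.add_sub_cancel]
  congr 1
  rw [pow_add, pow_add, pow_add]
  ring

theorem card_orig_eq (hπ : FixesOutside r π) {a b : ℕ} (h : (a, b) ∈ invSet r π) :
    (orig r π a b).card = (dest r π a b).card := by
  have h' := (mem_invSet_iff _ _).1 h
  rw [orig_eq hπ h, dest_eq hπ h, Finset.card_insert_of_notMem, card_destUpTo h'.2.2.2.le]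
  rw [mem_origUpTo, Equiv.apply_symm_apply]
  omega

theorem R_eq_signedSum (hπ : FixesOutside r π) {k : ℕ} (h : (π k, b) ∈ invSet r π) :
    R r π v (π k) b = signedSum r π v 0 b k (rightCol r π k) := by
  rw [signedSum_rightCol_of_mem hπ h, R, pathSets_eq_families, pathSum, if_pos (card_orig_eq hπ h)]

theorem RL_eq_signedSum (hπ : FixesOutside r π) {k : ℕ} (h : (π k, b) ∈ invSet r π) :
    RL r π v (π k) b = signedSum r π v r b k (rightCol r π k) := by
  rw [signedSum_rightCol_of_mem hπ h, RL, pathSetsL_eq_families, pathSum,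
    if_pos (card_orig_eq hπ h)]

theorem signedSum_symm (hπ : FixesOutside r π) {c : ℕ}
    (hc : (π.symm b, c) ∈ entries r π) : signedSum r π v e b (π.symm b) c =
      (-1) ^ linesRight r π (π.symm b) c *
        (rowProd r π v (π.symm b) c / rho r π v (π.symm b)) := by
  rw [signedSum, if_neg (lt_irrefl _), lowRow_self hc, origUpTo_symm, destUpTo_symm]
  have := pathSum_insert_row (v := v) (e := e) (Q := ∅) (B := ∅) hπ hc (by simp) (by simp) le_rfl
  rw [Equiv.apply_symm_apply, pathSum_empty, mul_one] at this
  have h2 : ({(π.symm b, b)} : Finset (ℕ × ℕ)) = insert (π.symm b, b) ∅ := rfl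
  rw [h2, this]
  simp [pow_add]

/-- The constants 0 and 1 obey the same formula as the replaced variables. Row `π⁻¹ b` gives `rho /
rho = 1`; above it the value is 0 by definition; below it a non-inversion has its one to the right
of `b`, so the right end is already an origin and no disjoint family exists. -/
theorem signedSum_rightCol_of_notMem (hπ : FixesOutside r π)
    (hv : ∀ p ∈ invSet r π, v p.1 p.2 ≠ 0) {k : ℕ} (h1 : 1 ≤ k) (h2 : k ≤ r)
    (hb : b ≤ r) (h : (π k, b) ∉ invSet r π) :
    signedSum r π v e b k (rightCol r π k) = nEntry r π v (π k) b := by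
  rw [nEntry, if_neg h]
  have hk := (mem_Icc_perm hπ k).2 ⟨h1, h2⟩
  rw [mem_invSet_iff, Equiv.symm_apply_apply] at h
  split_ifs with hkb
  · obtain rfl : k = π.symm b := by rw [← hkb, Equiv.symm_apply_apply]
    rw [signedSum_symm hπ (rightCol_spec hπ h1 h2), linesRight_rightCol hπ h1 h2,
      rowProd_rightCol, div_self (rho_ne_zero hv _), pow_zero, one_mul]
  · by_cases h3 : k < π.symm b
    · rw [signedSum, if_pos h3]
    · have h4 : k ≠ π.symm b := by
        rintro rfl
        exact hkb (Equiv.apply_symm_apply _ _)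
      obtain ⟨k, rfl⟩ : ∃ l, k = l + 1 := ⟨k - 1, by omega⟩
      rw [signedSum, if_neg h3, lowRow_self (rightCol_spec hπ h1 h2),
        origUpTo_succ_of_le (by omega) (by omega), destUpTo_succ_of_le (by omega) (by omega),
        pathSum_insert_insert_self row_lt_of_mem_origUpTo row_lt_of_mem_destUpTo
          (card_destUpTo (by omega)).symm, zero_div, mul_zero]

theorem wu_eq_signedSum (hπ : FixesOutside r π) (hv : ∀ p ∈ invSet r π, v p.1 p.2 ≠ 0) {k : ℕ}
    (h1 : 1 ≤ k) (h2 : k ≤ r) (hb : b ≤ r) :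
    wu r π v k b = signedSum r π v 0 b k (rightCol r π k) := by
  rw [wu, uEntry]
  split_ifs with h
  · exact R_eq_signedSum hπ h
  · exact (signedSum_rightCol_of_notMem hπ hv h1 h2 hb h).symm

theorem xL_eq_signedSum (hπ : FixesOutside r π) (hv : ∀ p ∈ invSet r π, v p.1 p.2 ≠ 0) {k : ℕ}
    (h1 : 1 ≤ k) (h2 : k ≤ r) (hb : b ≤ r) :
    xL r π v k b = signedSum r π v r b k (rightCol r π k) := by
  rw [xL]
  split_ifs with h
  · exact RL_eq_signedSum hπ h
  · rw [wu, uEntry, if_neg h, signedSum_rightCol_of_notMem hπ hv h1 h2 hb h]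

end

/-! ### Factorisation of `wu` through the values at the ones. -/

/-- The vector of signed sums over the paths that start in column `c` just above the row `k + 1`,
indexed by the columns of the ones in which the paths end. -/
noncomputable def pathVec {F : Type*} [Field F] (r : ℕ) (π : Equiv.Perm ℕ) (v : ℕ → ℕ → F)
    (e : ℕ) : ℕ → ℕ → ℕ → F
  | 0, _ => 0
  | k + 1, c =>
    if c < π (k + 1) then pathVec r π v e k c
    -- The second conjunct only serves termination; it holds automatically at entries of `wn`.
    else if _h : π (k + 1) < c ∧ leftCol r π (k + 1) c < c then
      wn r π v (k + 1) c • ((if c = e then 0 else pathVec r π v e k c) -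
        pathVec r π v e (k + 1) (leftCol r π (k + 1) c))
    else Pi.single c 1
  termination_by k c => (k, c)

/-- The signed sum for the start at the one in column `j`. -/
noncomputable def transition {F : Type*} [Field F] (r : ℕ) (π : Equiv.Perm ℕ) (v : ℕ → ℕ → F)
    (e j b : ℕ) : F :=
  signedSum r π v e b (π.symm j) j

section

variable {F : Type*} [Field F] {r : ℕ} {π : Equiv.Perm ℕ} {v : ℕ → ℕ → F} {e b : ℕ}

theorem pathVec_pass {k c : ℕ} (hc : c < π (k + 1)) :
    pathVec r π v e (k + 1) c = pathVec r π v e k c := by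
  rw [pathVec, if_pos hc]

theorem pathVec_step (hπ : FixesOutside r π) {k c : ℕ} (h : (k + 1, c) ∈ entries r π)
    (hc : π (k + 1) < c) :
    pathVec r π v e (k + 1) c = wn r π v (k + 1) c • ((if c = e then 0 else pathVec r π v e k c) -
        pathVec r π v e (k + 1) (leftCol r π (k + 1) c)) := by
  have h' := (mem_entries_iff hπ _ _).1 h
  rw [pathVec, if_neg hc.not_gt, dif_pos ⟨hc, (leftCol_spec hπ h'.1 h'.2.1 hc).2⟩]

theorem pathVec_perm (k : ℕ) :
    pathVec r π v e (k + 1) (π (k + 1)) = Pi.single (π (k + 1)) 1 := by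
  rw [pathVec, if_neg (lt_irrefl _), dif_neg fun h => lt_irrefl _ h.1]

/-- The induction along the recursion that defines `pathVec`. -/
theorem lines_induction (hπ : FixesOutside r π) {p : ℕ → ℕ → Prop}
    (pass : ∀ k c, k + 1 ≤ r → 1 ≤ c → c < π (k + 1) → π.symm c ≤ k → p k c → p (k + 1) c)
    (step : ∀ k c, (k + 1, c) ∈ entries r π → π (k + 1) < c → π.symm c ≤ k → p k c →
      p (k + 1) (leftCol r π (k + 1) c) → p (k + 1) c)
    (perm : ∀ k, k + 1 ≤ r → p (k + 1) (π (k + 1)))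
    {k c : ℕ} (hk : k ≤ r) (hc1 : 1 ≤ c) (hc : c ≤ r) (hck : π.symm c ≤ k) : p k c := by
  induction k generalizing c with
  | zero =>
    have := (mem_Icc_perm_symm hπ c).2 ⟨hc1, hc⟩
    omega
  | succ k ihk =>
    induction c using Nat.strong_induction_on with
    | _ c ih =>
      have hne : c ≠ π (k + 1) → π.symm c ≤ k := by
        intro h
        rw [Ne, ← Equiv.symm_apply_eq] at h
        omega
      rcases lt_trichotomy c (π (k + 1)) with h | h | h
      · exact pass k c hk hc1 h (hne h.ne) (ihk (by omega) hc1 hc (hne h.ne))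
      · subst h
        exact perm k hk
      · have h1 : (k + 1, c) ∈ entries r π := (mem_entries_iff hπ _ _).2 (by omega)
        obtain ⟨h2, h3⟩ := leftCol_spec hπ (by omega) hk h
        have h4 := le_of_mem_entries h2
        exact step k c h1 h (hne h.ne') (ihk (by omega) hc1 hc (hne h.ne'))
          (ih _ h3 h4.1 h4.2 ((mem_entries_iff hπ _ _).1 h2).2.2.2)

/-- Both sides satisfy the same linear recursion and agree at the ones, where `pathVec` is a unit
vector; all dependence on `b` sits in `transition`. -/
theorem signedSum_eq_sum (hπ : FixesOutside r π) (hv : ∀ p ∈ invSet r π, v p.1 p.2 ≠ 0)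
    {k c : ℕ} (hk : k ≤ r) (hc1 : 1 ≤ c) (hc : c ≤ r) (hck : π.symm c ≤ k) :
    signedSum r π v e b k c =
      ∑ j ∈ Finset.Icc 1 r, pathVec r π v e k c j * transition r π v e j b := by
  refine lines_induction hπ (p := fun k c => signedSum r π v e b k c =
      ∑ j ∈ Finset.Icc 1 r, pathVec r π v e k c j * transition r π v e j b) ?_ ?_ ?_ hk hc1 hc hck
  · intro k c hk hc1 hc hck ih
    rw [signedSum_pass hπ hv hk hc1 hc hck, ih, pathVec_pass hc]
  · intro k c h hc _ ih1 ih2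
    rw [signedSum_step hπ hv h hc, ih1, ih2, pathVec_step hπ h hc]
    split_ifs with hce
    · simp only [Pi.smul_apply, Pi.neg_apply, smul_eq_mul, zero_sub, mul_assoc,
        ← Finset.mul_sum, neg_mul, Finset.sum_neg_distrib]
    · simp only [Pi.smul_apply, Pi.sub_apply, smul_eq_mul, mul_assoc,
        ← Finset.mul_sum, sub_mul, Finset.sum_sub_distrib]
  · intro k hk
    rw [pathVec_perm, Finset.sum_eq_single (π (k + 1))]
    · rw [Pi.single_eq_same, one_mul, transition, Equiv.symm_apply_apply]
    · intro j _ hj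
      rw [Pi.single_eq_of_ne hj, zero_mul]
    · intro h
      rw [Finset.mem_Icc] at h
      exact absurd ((mem_Icc_perm hπ (k + 1)).2 (by omega)) h

theorem transition_of_lt {j : ℕ} (h : j < b) : transition r π v e j b = 0 :=
  signedSum_eq_zero_of_lt h

theorem transition_self (hπ : FixesOutside r π) (hb1 : 1 ≤ b) (hb : b ≤ r) :
    transition r π v e b b =
      (-1) ^ linesRight r π (π.symm b) b * (1 / rho r π v (π.symm b)) := by
  have h := (mem_Icc_perm_symm hπ b).2 ⟨hb1, hb⟩
  have h1 := perm_mem_entries hπ h.1 h.2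
  have h2 := rowProd_perm (v := v) hπ h.1 h.2
  rw [Equiv.apply_symm_apply] at h1 h2
  rw [transition, signedSum_symm hπ h1, h2]

/-- The row vector of signed path sums for the paths that start at the right end of row `k`. -/
noncomputable def rowVec (r : ℕ) (π : Equiv.Perm ℕ) (v : ℕ → ℕ → F) (e k : ℕ) : ℕ → F :=
  pathVec r π v e k (rightCol r π k)

theorem wu_eq_sum (hπ : FixesOutside r π) (hv : ∀ p ∈ invSet r π, v p.1 p.2 ≠ 0) {k : ℕ}
    (h1 : 1 ≤ k) (h2 : k ≤ r) (hb : b ≤ r) :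
    wu r π v k b = ∑ j ∈ Finset.Icc 1 r, rowVec r π v 0 k j * transition r π v 0 j b := by
  have h := rightCol_spec hπ h1 h2
  have h' := le_of_mem_entries h
  rw [wu_eq_signedSum hπ hv h1 h2 hb, rowVec,
    signedSum_eq_sum hπ hv h2 h'.1 h'.2 ((mem_entries_iff hπ _ _).1 h).2.2.2]

theorem xL_eq_sum (hπ : FixesOutside r π) (hv : ∀ p ∈ invSet r π, v p.1 p.2 ≠ 0) {k : ℕ}
    (h1 : 1 ≤ k) (h2 : k ≤ r) (hb : b ≤ r) :
    xL r π v k b = ∑ j ∈ Finset.Icc 1 r, rowVec r π v r k j * transition r π v r j b := by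
  have h := rightCol_spec hπ h1 h2
  have h' := le_of_mem_entries h
  rw [xL_eq_signedSum hπ hv h1 h2 hb, rowVec,
    signedSum_eq_sum hπ hv h2 h'.1 h'.2 ((mem_entries_iff hπ _ _).1 h).2.2.2]

/-- Starting to the left of column `r`, the recursion never enters it, so closing that column has no
effect and the one in it is not reached. -/
theorem pathVec_of_ne (hπ : FixesOutside r π) {k c : ℕ} (hk : k ≤ r) (hc1 : 1 ≤ c) (hc : c ≤ r)
    (hck : π.symm c ≤ k) (hcr : c ≠ r) :
    pathVec r π v 0 k c = pathVec r π v r k c ∧ pathVec r π v r k c r = 0 := by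
  refine lines_induction hπ (p := fun k c => c ≠ r → pathVec r π v 0 k c = pathVec r π v r k c ∧
    pathVec r π v r k c r = 0) ?_ ?_ ?_ hk hc1 hc hck hcr
  · intro k c _ _ hc _ ih hcr
    rw [pathVec_pass hc, pathVec_pass hc]
    exact ih hcr
  · intro k c h hc _ ih1 ih2 hcr
    have h1 := (mem_entries_iff hπ _ _).1 h
    have h2 := le_of_mem_entries h
    have h3 := (leftCol_spec hπ h1.1 h1.2.1 hc).2
    rw [pathVec_step hπ h hc, pathVec_step hπ h hc, if_neg hcr, if_neg (by omega),
      (ih1 hcr).1, (ih2 (by omega)).1]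
    simp [(ih1 hcr).2, (ih2 (by omega)).2]
  · intro k _ hkr
    rw [pathVec_perm, pathVec_perm]
    exact ⟨rfl, Pi.single_eq_of_ne hkr.symm _⟩

theorem rightCol_eq_iff (hπ : FixesOutside r π) {k : ℕ} (h1 : 1 ≤ k) (h2 : k ≤ r) :
    rightCol r π k = r ↔ π.symm r ≤ k := by
  have h := rightCol_spec hπ h1 h2
  have h' := (mem_Icc_perm hπ k).2 ⟨h1, h2⟩
  constructor
  · intro hr
    rw [hr, mem_entries_iff hπ] at h
    exact h.2.2.2
  · intro hr
    exact le_antisymm (le_of_mem_entries h).2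
      (le_rightCol ((mem_entries_iff hπ k r).2 ⟨h1, h2, h'.2, hr⟩))

theorem rowVec_of_lt (hπ : FixesOutside r π) {k : ℕ} (h1 : 1 ≤ k) (h2 : k ≤ r)
    (hk : k < π.symm r) :
    rowVec r π v 0 k = rowVec r π v r k ∧ rowVec r π v r k r = 0 := by
  have h := rightCol_spec hπ h1 h2
  have h' := le_of_mem_entries h
  refine pathVec_of_ne hπ h2 h'.1 h'.2 ((mem_entries_iff hπ _ _).1 h).2.2.2 ?_
  rw [Ne, rightCol_eq_iff hπ h1 h2]
  omega

theorem rowVec_symm (hπ : FixesOutside r π) (hr : 1 ≤ r) :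
    rowVec r π v e (π.symm r) = Pi.single r 1 := by
  have h := (mem_Icc_perm_symm hπ r).2 ⟨hr, le_rfl⟩
  rw [rowVec, (rightCol_eq_iff hπ h.1 h.2).2 le_rfl]
  obtain ⟨k, hk⟩ : ∃ k, π.symm r = k + 1 := ⟨π.symm r - 1, by omega⟩
  have hk' : π (k + 1) = r := by rw [← hk, Equiv.apply_symm_apply]
  have := pathVec_perm (r := r) (π := π) (v := v) (e := e) k
  rw [hk'] at this
  rw [hk, this]

/-- Below `1_r`, column `r` has an entry in every row, so the step up from the right end of row `k +
1` reaches the right end of row `k`. The other first step, to the left, is exactly what `e = r`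
retains. -/
theorem rowVec_of_gt (hπ : FixesOutside r π) {k : ℕ} (h2 : k + 1 ≤ r)
    (hk : π.symm r < k + 1) :
    rowVec r π v 0 (k + 1) =
        wn r π v (k + 1) r • rowVec r π v 0 k + rowVec r π v r (k + 1) ∧
      rowVec r π v r (k + 1) r = 0 := by
  have hr := (mem_Icc_perm_symm hπ r).2 (by omega)
  have hk1 := (mem_Icc_perm hπ (k + 1)).2 (by omega)
  have hne : π (k + 1) ≠ r := by
    intro h
    rw [← h, Equiv.symm_apply_apply] at hk
    exact lt_irrefl _ hk
  have hent : (k + 1, r) ∈ entries r π := (mem_entries_iff hπ _ _).2 (by omega)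
  have hlt : π (k + 1) < r := by omega
  obtain ⟨h3, h4⟩ := leftCol_spec hπ (by omega) h2 hlt
  have h5 := le_of_mem_entries h3
  have h6 := pathVec_of_ne (v := v) hπ h2 h5.1 h5.2 ((mem_entries_iff hπ _ _).1 h3).2.2.2 h4.ne
  rw [rowVec, rowVec, rowVec, (rightCol_eq_iff hπ (by omega) h2).2 hk.le,
    (rightCol_eq_iff hπ (by omega) (by omega)).2 (by omega), pathVec_step hπ hent hlt,
    pathVec_step hπ hent hlt, if_pos rfl, if_neg (by omega), h6.1]
  constructor
  · rw [smul_sub, zero_sub, smul_neg, sub_eq_add_neg]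
  · simp [h6.2]

end

/-! ### Determinants under the triangular factorisation. -/

section

variable {F : Type*} [Field F]

/-- Right multiplication by a lower triangular matrix. -/
theorem det_of_sum_mul_lowerTriangular {r m n : ℕ} (hm : 1 ≤ m) (hr : m + n ≤ r + 1)
    (Y : Fin n → ℕ → F) (hY : ∀ a j, m + n ≤ j → j ≤ r → Y a j = 0) (L : ℕ → ℕ → F)
    (hL : ∀ j b, j < b → L j b = 0) :
    (Matrix.of fun a c : Fin n => ∑ j ∈ Finset.Icc 1 r, Y a j * L j (m + c)).det =
      (Matrix.of fun a c : Fin n => Y a (m + c)).det * ∏ c : Fin n, L (m + c) (m + c) := by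
  have h1 : (Matrix.of fun a c : Fin n => ∑ j ∈ Finset.Icc 1 r, Y a j * L j (m + c)) =
      (Matrix.of fun a c : Fin n => Y a (m + c)) *
        Matrix.of fun a c : Fin n => L (m + a) (m + c) := by
    ext a c
    rw [Matrix.mul_apply]
    simp only [Matrix.of_apply]
    rw [Fin.sum_univ_eq_sum_range (fun j => Y a (m + j) * L (m + j) (m + c)),
      Finset.range_eq_Ico, Finset.sum_Ico_add (fun j => Y a j * L j (m + c))]
    symm
    refine Finset.sum_subset ?_ ?_
    · intro j hj
      rw [Finset.mem_Ico] at hj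
      rw [Finset.mem_Icc]
      omega
    · intro j hj hj'
      rw [Finset.mem_Icc] at hj
      rw [Finset.mem_Ico] at hj'
      by_cases h : m + n ≤ j
      · rw [hY a j h hj.2, zero_mul]
      · rw [hL j (m + c) (by omega), mul_zero]
  rw [h1, Matrix.det_mul]
  congr 1
  rw [Matrix.det_of_isLowerTriangular]
  · rfl
  · intro a c hac
    exact hL _ _ (by
      have : a < c := hac
      simpa using this)

/-- Expansion along a last column with a single nonzero entry. -/
theorem det_expand_last {m n : ℕ} (Z : Fin (n + 1) → ℕ → F) (s : Fin (n + 1))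
    (hZ : ∀ a, a ≠ s → Z a (m + n) = 0) :
    (Matrix.of fun a c : Fin (n + 1) => Z a (m + c)).det = (-1) ^ (s + n : ℕ) * Z s (m + n) *
      (Matrix.of fun a c : Fin n => Z (s.succAbove a) (m + c)).det := by
  rw [Matrix.det_succ_column _ (Fin.last n), Finset.sum_eq_single s]
  · simp only [Matrix.of_apply, Fin.val_last]
    congr 2
    ext a c
    simp [Fin.succAbove_last]
  · intro a _ ha
    simp [hZ a ha]
  · simp

variable {r : ℕ} {π : Equiv.Perm ℕ} {v : ℕ → ℕ → F} {e b : ℕ}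

/-- The row of `1_r` has no other nonzero entry, so its `rho` is 1. -/
theorem transition_last (hπ : FixesOutside r π) (hr : 1 ≤ r) :
    transition r π v e r r = 1 := by
  have h := (mem_Icc_perm_symm hπ r).2 ⟨hr, le_rfl⟩
  have h1 := perm_mem_entries hπ h.1 h.2
  rw [Equiv.apply_symm_apply] at h1
  have h2 := rowProd_perm (v := v) hπ h.1 h.2
  have h3 := (rightCol_eq_iff hπ h.1 h.2).2 le_rfl
  have h5 := rowProd_rightCol (r := r) (π := π) (v := v) (π.symm r)
  rw [Equiv.apply_symm_apply] at h2
  rw [h3, h2] at h5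
  have h4 := linesRight_rightCol hπ h.1 h.2
  rw [h3] at h4
  rw [transition_self hπ hr le_rfl, ← h5, h4]
  simp

theorem wu_last (hπ : FixesOutside r π) (hv : ∀ p ∈ invSet r π, v p.1 p.2 ≠ 0) {k : ℕ}
    (h1 : 1 ≤ k) (h2 : k ≤ r) : wu r π v k r = rowVec r π v 0 k r := by
  rw [wu_eq_sum hπ hv h1 h2 le_rfl, Finset.sum_eq_single r, transition_last hπ (by omega), mul_one]
  · intro j hj hjr
    rw [Finset.mem_Icc] at hj
    rw [transition_of_lt (by omega), mul_zero]
  · intro h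
    exact absurd (Finset.mem_Icc.2 ⟨by omega, le_rfl⟩) h

theorem rowVec_last_ne_zero (hπ : FixesOutside r π) (hv : ∀ p ∈ invSet r π, v p.1 p.2 ≠ 0) {k : ℕ}
    (h1 : π.symm r ≤ k) (h2 : k ≤ r) (hr : 1 ≤ r) : rowVec r π v 0 k r ≠ 0 := by
  induction k, h1 using Nat.le_induction with
  | base => rw [rowVec_symm hπ hr]; simp
  | succ k hk ih =>
    have hk1 := (mem_Icc_perm hπ (k + 1)).2 (by omega)
    obtain ⟨h3, h4⟩ := rowVec_of_gt (v := v) hπ h2 (by omega)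
    rw [h3]
    simp only [Pi.add_apply, Pi.smul_apply, h4, add_zero, smul_eq_mul]
    exact mul_ne_zero (wn_ne_zero hv ((mem_entries_iff hπ _ _).2 (by omega))) (ih (by omega))

theorem det_wu (hπ : FixesOutside r π) (hv : ∀ p ∈ invSet r π, v p.1 p.2 ≠ 0) {m n : ℕ}
    (hm : 1 ≤ m) (hr : r = m + n) (f : Fin (n + 1) → ℕ) (hf : ∀ a, 1 ≤ f a ∧ f a ≤ r) :
    (Matrix.of fun a c : Fin (n + 1) => wu r π v (f a) (m + c)).det =
      (Matrix.of fun a c : Fin (n + 1) => rowVec r π v 0 (f a) (m + c)).det *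
        ∏ c : Fin n, transition r π v 0 (m + c) (m + c) := by
  have h1 : (Matrix.of fun a c : Fin (n + 1) => wu r π v (f a) (m + c)) =
      Matrix.of fun a c : Fin (n + 1) => ∑ j ∈ Finset.Icc 1 r,
        rowVec r π v 0 (f a) j * transition r π v 0 j (m + c) := by
    ext a c
    exact wu_eq_sum hπ hv (hf a).1 (hf a).2 (by omega)
  rw [h1, det_of_sum_mul_lowerTriangular hm (by omega) (fun a => rowVec r π v 0 (f a))
    (fun a j h1 h2 => by omega) _ fun j b => transition_of_lt, Fin.prod_univ_castSucc]
  simp only [Fin.val_castSucc, Fin.val_last, ← hr]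
  rw [transition_last hπ (by omega), mul_one]

theorem det_xL (hπ : FixesOutside r π) (hv : ∀ p ∈ invSet r π, v p.1 p.2 ≠ 0) {m n : ℕ}
    (hm : 1 ≤ m) (hr : r = m + n) (f : Fin n → ℕ)
    (hf : ∀ a, 1 ≤ f a ∧ f a ≤ r ∧ f a ≠ π.symm r) :
    (Matrix.of fun a c : Fin n => xL r π v (f a) (m + c)).det =
      (Matrix.of fun a c : Fin n => rowVec r π v r (f a) (m + c)).det *
        ∏ c : Fin n, transition r π v 0 (m + c) (m + c) := by
  have h1 : (Matrix.of fun a c : Fin n => xL r π v (f a) (m + c)) =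
      Matrix.of fun a c : Fin n => ∑ j ∈ Finset.Icc 1 r,
        rowVec r π v r (f a) j * transition r π v r j (m + c) := by
    ext a c
    exact xL_eq_sum hπ hv (hf a).1 (hf a).2.1 (by omega)
  have h2 : ∀ a : Fin n, ∀ j, m + n ≤ j → j ≤ r → rowVec r π v r (f a) j = 0 := by
    intro a j h2 h3
    have hj : j = r := by omega
    rw [hj]
    obtain ⟨h4, h5, h6⟩ := hf a
    rcases lt_or_gt_of_ne h6 with h7 | h7
    · exact (rowVec_of_lt hπ h4 h5 h7).2
    · obtain ⟨k, hk⟩ : ∃ k, f a = k + 1 := ⟨f a - 1, by omega⟩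
      rw [hk] at h5 h7 ⊢
      exact (rowVec_of_gt hπ h5 h7).2
  have h3 := det_of_sum_mul_lowerTriangular (r := r) hm (by omega) (fun a => rowVec r π v r (f a)) h2
    (transition r π v r) (fun j b => transition_of_lt)
  -- The triangular matrices for `e = 0` and `e = r` may differ off the diagonal, but their
  -- diagonals involve only `rho` and `linesRight`.
  have h4 : ∏ c : Fin n, transition r π v r (m + c) (m + c) =
      ∏ c : Fin n, transition r π v 0 (m + c) (m + c) := by
    refine Finset.prod_congr rfl fun c _ => ?_
    rw [transition_self hπ (by omega) (by omega), transition_self hπ (by omega) (by omega)]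
  rw [h1, h3, h4]

end

/-! ### Row reduction of `T_i` and `F_i`. -/

section

variable {F : Type*} [Field F] {r : ℕ} {π : Equiv.Perm ℕ} {v : ℕ → ℕ → F}

theorem wu_last_of_lt (hπ : FixesOutside r π) (hv : ∀ p ∈ invSet r π, v p.1 p.2 ≠ 0) {k : ℕ}
    (h1 : 1 ≤ k) (h2 : k < π.symm r) (hr : 1 ≤ r) : wu r π v k r = 0 := by
  have h := (mem_Icc_perm_symm hπ r).2 ⟨hr, le_rfl⟩
  have h3 := rowVec_of_lt (v := v) hπ h1 (by omega) h2
  rw [wu_last hπ hv h1 (by omega), h3.1, h3.2]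

theorem det_T_eq (hπ : FixesOutside r π) (hv : ∀ p ∈ invSet r π, v p.1 p.2 ≠ 0) {m n : ℕ}
    (hm : 1 ≤ m) (hr : r = m + n) (s : Fin (n + 1)) (hs : (s : ℕ) = π.symm r - m) :
    (Matrix.of fun a c : Fin (n + 1) => wu r π v (m + a) (m + c)).det =
      (-1) ^ (s + n : ℕ) * wu r π v (m + s) r *
        (Matrix.of fun a c : Fin n => xL r π v
          (if π.symm r < m then m + 1 + a else if m + a < π.symm r then m + a else m + 1 + a)
          (m + c)).det := by
  have hp := (mem_Icc_perm_symm hπ r).2 (by omega)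
  rw [det_wu hπ hv hm hr (fun a => m + a) fun a => by omega,
    det_xL hπ hv hm hr _ fun a => by split_ifs <;> omega]
  -- Subtracting from each row below `1_r`, except the top row of the matrix, its multiple of the
  -- preceding row turns it into the `e = r` version. Row `s` alone keeps a nonzero last entry: the
  -- row of `1_r`, or the top row if `1_r` lies higher, where the truncated difference gives `s =
  -- 0`.
  let Z : Fin (n + 1) → ℕ → F := fun a =>
    if m + a ≤ π.symm r ∨ (a : ℕ) = 0 then rowVec r π v 0 (m + a) else rowVec r π v r (m + a)
  have h1 : (Matrix.of fun a c : Fin (n + 1) => rowVec r π v 0 (m + a) (m + c)).det =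
      (Matrix.of fun a c : Fin (n + 1) => Z a (m + c)).det := by
    refine Matrix.det_eq_of_forall_row_eq_smul_add_pred
      (fun a => if m + (a + 1) ≤ π.symm r then 0 else wn r π v (m + a + 1) r) ?_ ?_
    · intro c
      simp [Z]
    · intro a c
      simp only [Matrix.of_apply, Z, Fin.val_succ, Fin.val_castSucc]
      by_cases h : m + (a + 1) ≤ π.symm r
      · simp [h]
      · simp only [h, if_false, false_or, Nat.add_eq_zero_iff, one_ne_zero, and_false]
        rw [← add_assoc, (rowVec_of_gt hπ (k := m + a) (by omega) (by omega)).1]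
        simp [add_comm]
  have h2 : ∀ a, a ≠ s → Z a (m + n) = 0 := by
    intro a ha
    have ha' : (a : ℕ) ≠ s := fun h => ha (Fin.ext h)
    simp only [Z, ← hr]
    split_ifs with h
    · have h3 := rowVec_of_lt (v := v) hπ (k := m + a) (by omega) (by omega) (by omega)
      rw [h3.1, h3.2]
    · obtain ⟨k, hk⟩ : ∃ k, m + (a : ℕ) = k + 1 := ⟨m + a - 1, by omega⟩
      rw [hk]
      exact (rowVec_of_gt hπ (by omega) (by omega)).2
  have h3 : Z s (m + n) = wu r π v (m + s) r := by
    rw [wu_last hπ hv (by omega) (by omega)]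
    simp only [Z, ← hr]
    rw [if_pos (by omega)]
  have h4 : ∀ a : Fin n, Z (s.succAbove a) = rowVec r π v r
      (if π.symm r < m then m + 1 + a else if m + a < π.symm r then m + a else m + 1 + a) := by
    intro a
    by_cases h : m + (a : ℕ) < π.symm r
    · rw [Fin.succAbove_of_castSucc_lt _ _ (by rw [Fin.lt_def, Fin.val_castSucc]; omega),
        if_neg (by omega), if_pos h]
      simp only [Z, Fin.val_castSucc]
      rw [if_pos (by omega), (rowVec_of_lt (v := v) hπ (by omega) (by omega) h).1]
    · rw [Fin.succAbove_of_le_castSucc _ _ (by rw [Fin.le_def, Fin.val_castSucc]; omega),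
        if_neg h, ite_self]
      simp only [Z, Fin.val_succ]
      rw [if_neg (by omega), add_assoc, add_comm 1]
  rw [h1, det_expand_last Z s h2, h3]
  simp only [h4]
  ring

/-- A matrix with rows `rowVec r π v 0 k` below the first row, if the line of `1_r` starts above
the second row. -/
theorem det_of_cons_rowVec (hπ : FixesOutside r π) {m n : ℕ}
    (hr : r = m + (n + 1)) (hp : π.symm r ≤ m) (x : ℕ → F) (hx : x r = 0) :
    (Matrix.of fun a c : Fin (n + 2) =>
        (if (a : ℕ) = 0 then x else rowVec r π v 0 (m + a)) (m + c)).det =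
      (-1) ^ n * rowVec r π v 0 (m + 1) r * (Matrix.of fun a c : Fin (n + 1) =>
        (if (a : ℕ) = 0 then x else rowVec r π v r (m + 1 + a)) (m + c)).det := by
  -- The second row has no suitable predecessor in the matrix, so it is left alone and becomes the
  -- pivot of the last column; the reduction starts with the third row.
  let Z : Fin (n + 2) → ℕ → F := fun a =>
    if (a : ℕ) = 0 then x else if (a : ℕ) = 1 then rowVec r π v 0 (m + 1) else
      rowVec r π v r (m + a)
  have h1 : (Matrix.of fun a c : Fin (n + 2) =>
        (if (a : ℕ) = 0 then x else rowVec r π v 0 (m + a)) (m + c)).det =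
      (Matrix.of fun a c : Fin (n + 2) => Z a (m + c)).det := by
    refine Matrix.det_eq_of_forall_row_eq_smul_add_pred
      (fun a => if (a : ℕ) = 0 then 0 else wn r π v (m + a + 1) r) ?_ ?_
    · intro c
      simp [Z]
    · intro a c
      simp only [Matrix.of_apply, Z, Fin.val_succ, Fin.val_castSucc]
      by_cases h : (a : ℕ) = 0
      · simp [h]
      · simp only [h, if_false, Nat.add_eq_zero_iff, one_ne_zero, and_false, Nat.add_eq_right]
        rw [← add_assoc, (rowVec_of_gt hπ (k := m + a) (by omega) (by omega)).1]
        simp [add_comm]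
  have h2 : ∀ a, a ≠ 1 → Z a (m + (n + 1)) = 0 := by
    intro a ha
    have ha' : (a : ℕ) ≠ 1 := fun h => ha (Fin.ext h)
    simp only [Z, ← hr]
    split_ifs with h
    · exact hx
    · obtain ⟨k, hk⟩ : ∃ k, m + (a : ℕ) = k + 1 := ⟨m + a - 1, by omega⟩
      rw [hk]
      exact (rowVec_of_gt hπ (by omega) (by omega)).2
  have h3 : Z 1 (m + (n + 1)) = rowVec r π v 0 (m + 1) r := by
    simp [Z, ← hr]
  have h4 : ∀ a : Fin (n + 1), Z ((1 : Fin (n + 2)).succAbove a) =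
      if (a : ℕ) = 0 then x else rowVec r π v r (m + 1 + a) := by
    intro a
    by_cases h : (a : ℕ) = 0
    · rw [Fin.succAbove_of_castSucc_lt _ _ (by rw [Fin.lt_def, Fin.val_castSucc, h]; simp)]
      simp only [Z, Fin.val_castSucc, h, if_true]
    · rw [Fin.succAbove_of_le_castSucc _ _ (by
        rw [Fin.le_def, Fin.val_castSucc, Fin.val_one]; omega)]
      simp only [Z, Fin.val_succ]
      rw [if_neg (by omega), if_neg (by omega), if_neg h, add_assoc, add_comm 1]
  rw [h1, det_expand_last Z 1 h2, h3]
  simp only [h4, Fin.val_one, pow_add]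
  ring

theorem det_cons_linear {n m : ℕ} (w : F) (x y z : ℕ → F) (hxyz : z = w • x + y)
    (W : Fin (n + 1) → ℕ → F) :
    (Matrix.of fun a c : Fin (n + 1) => (if (a : ℕ) = 0 then z else W a) (m + c)).det =
      w * (Matrix.of fun a c : Fin (n + 1) => (if (a : ℕ) = 0 then x else W a) (m + c)).det +
        (Matrix.of fun a c : Fin (n + 1) => (if (a : ℕ) = 0 then y else W a) (m + c)).det := by
  have key : ∀ t : ℕ → F,
      (Matrix.of fun a c : Fin (n + 1) => (if (a : ℕ) = 0 then t else W a) (m + c)) =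
        Matrix.updateRow (Matrix.of fun a c : Fin (n + 1) => W a (m + c)) 0
          (fun c => t (m + c)) := by
    intro t
    ext a c
    by_cases h : a = 0
    · simp [h]
    · rw [Matrix.updateRow_ne h]
      simp [h]
  rw [key, key, key, ← Matrix.det_updateRow_smul, ← Matrix.det_updateRow_add, hxyz]
  rfl

/-- After the factorisation, the matrices of `T_i` and `F_i` differ only in the top row. By
`rowVec_of_gt` the top row of the former is a multiple of that of the latter plus a row with last
coordinate 0, and `det_of_cons_rowVec` evaluates the remainder. -/
theorem det_F_of_symm_lt (hπ : FixesOutside r π) (hv : ∀ p ∈ invSet r π, v p.1 p.2 ≠ 0)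
    {m n : ℕ} (hm : 2 ≤ m) (hr : r = m + n) (hp : π.symm r < m) :
    (Matrix.of fun a c : Fin (n + 1) => wu r π v (m + a) (m + c)).det =
      wn r π v m r * (Matrix.of fun a c : Fin (n + 1) =>
          wu r π v (if (a : ℕ) = 0 then m - 1 else m + a) (m + c)).det +
        (-1) ^ (n + 1) * uEntry r π v (π (m + 1)) r * (Matrix.of fun a c : Fin n => xL r π v
          (if (a : ℕ) = 0 then m else m + 1 + a) (m + c)).det := by
  obtain ⟨k, rfl⟩ : ∃ k, m = k + 1 := ⟨m - 1, by omega⟩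
  obtain ⟨h1, h2⟩ := rowVec_of_gt (v := v) hπ (k := k) (by omega) hp
  have h3 := det_cons_linear (m := k + 1) (n := n) _ _ _ _ h1
    (fun a => rowVec r π v 0 (k + 1 + a))
  have h4 : ∀ a : Fin (n + 1), (if (a : ℕ) = 0 then rowVec r π v 0 (k + 1)
      else rowVec r π v 0 (k + 1 + a)) = rowVec r π v 0 (k + 1 + a) := by
    intro a
    split_ifs with h
    · rw [h, add_zero]
    · rfl
  simp only [h4] at h3
  rw [det_wu hπ hv (by omega) hr (fun a => k + 1 + a) fun a => by omega,
    det_wu hπ hv (by omega) hr _ fun a => by split_ifs <;> omega, h3]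
  simp only [Nat.add_sub_cancel, apply_ite (rowVec r π v 0)]
  rw [add_mul, mul_assoc]
  congr 1
  -- For size 1 there is no second row: the remainder is 0, and so is `u_{π(r+1),r}`, because `π`
  -- fixes `r + 1`.
  rcases n with _ | n
  · have h5 : uEntry r π v (π (k + 1 + 1)) r = 0 := by
      have h6 : π (k + 1 + 1) = r + 1 := by
        rw [hπ _ (by rw [Finset.mem_Icc]; omega)]
        omega
      rw [h6, uEntry, if_neg (by rw [mem_invSet_iff]; omega), nEntry, if_neg (by omega),
        if_neg (by rw [mem_invSet_iff]; omega)]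
    rw [h5]
    simp only [add_zero] at hr
    have h6 : rowVec r π v r (k + 1) (k + 1) = 0 :=
      (congrArg (rowVec r π v r (k + 1)) hr.symm).trans h2
    simp [h6]
  · have h5 := det_of_cons_rowVec (v := v) hπ hr hp.le _ h2
    rw [h5, det_xL hπ hv (by omega) hr _ fun a => by split_ifs <;> omega,
      ← wu_last hπ hv (by omega) (by omega), wu]
    simp only [apply_ite (rowVec r π v r)]
    ring

theorem det_F_of_symm_eq (hπ : FixesOutside r π) (hv : ∀ p ∈ invSet r π, v p.1 p.2 ≠ 0)
    {m n : ℕ} (hm : 2 ≤ m) (hr : r = m + (n + 1)) (hp : π.symm r = m) :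
    (Matrix.of fun a c : Fin (n + 2) =>
        wu r π v (if (a : ℕ) = 0 then m - 1 else m + a) (m + c)).det =
      (-1) ^ (n + 2) * uEntry r π v (π (m + 1)) r * (Matrix.of fun a c : Fin (n + 1) => xL r π v
          (if (a : ℕ) = 0 then m - 1 else m + 1 + a) (m + c)).det := by
  obtain ⟨h1, h2⟩ := rowVec_of_lt (v := v) hπ (k := m - 1) (by omega) (by omega) (by omega)
  have h5 := det_of_cons_rowVec (v := v) hπ hr hp.le _ h2
  rw [det_wu hπ hv (by omega) hr _ fun a => by split_ifs <;> omega,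
    det_xL hπ hv (by omega) hr _ fun a => by split_ifs <;> omega]
  simp only [apply_ite (rowVec r π v 0), apply_ite (rowVec r π v r), h1]
  rw [h5, ← wu_last hπ hv (by omega) (by omega), wu]
  ring

theorem det_F_of_lt_symm (hπ : FixesOutside r π) (hv : ∀ p ∈ invSet r π, v p.1 p.2 ≠ 0)
    {m n : ℕ} (hm : 2 ≤ m) (hr : r = m + n) (hp : m < π.symm r) :
    (Matrix.of fun a c : Fin (n + 1) =>
        wu r π v (if (a : ℕ) = 0 then m - 1 else m + a) (m + c)).det =
      (-1) ^ (r - π.symm r) * (Matrix.of fun a c : Fin n => xL r π v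
          (if (a : ℕ) = 0 then m - 1 else if m + a < π.symm r then m + a else m + 1 + a)
          (m + c)).det := by
  have hpr := (mem_Icc_perm_symm hπ r).2 (by omega)
  rw [det_wu hπ hv (by omega) hr _ fun a => by split_ifs <;> omega,
    det_xL hπ hv (by omega) hr _ fun a => by split_ifs <;> omega]
  let Z : Fin (n + 1) → ℕ → F := fun a =>
    if (a : ℕ) = 0 then rowVec r π v 0 (m - 1) else
      if m + a ≤ π.symm r then rowVec r π v 0 (m + a) else rowVec r π v r (m + a)
  have h1 : (Matrix.of fun a c : Fin (n + 1) =>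
        rowVec r π v 0 (if (a : ℕ) = 0 then m - 1 else m + a) (m + c)).det =
      (Matrix.of fun a c : Fin (n + 1) => Z a (m + c)).det := by
    refine Matrix.det_eq_of_forall_row_eq_smul_add_pred
      (fun a => if m + (a + 1) ≤ π.symm r then 0 else wn r π v (m + a + 1) r) ?_ ?_
    · intro c
      simp [Z]
    · intro a c
      simp only [Matrix.of_apply, Z, Fin.val_succ, Fin.val_castSucc]
      by_cases h : m + (a + 1) ≤ π.symm r
      · simp [h]
      · have ha : (a : ℕ) ≠ 0 := by omega
        simp only [h, ha, if_false, Nat.add_eq_zero_iff, one_ne_zero, and_false]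
        rw [← add_assoc, (rowVec_of_gt hπ (k := m + a) (by omega) (by omega)).1]
        simp [add_comm]
  -- The row of `1_r` lies strictly below the top row of `F_i`, so the pivot is the entry 1 itself
  -- and no factor `u` appears.
  let s : Fin (n + 1) := ⟨π.symm r - m, by omega⟩
  have hs : (s : ℕ) = π.symm r - m := rfl
  have h2 : ∀ a, a ≠ s → Z a (m + n) = 0 := by
    intro a ha
    have ha' : (a : ℕ) ≠ s := fun h => ha (Fin.ext h)
    simp only [Z, ← hr]
    split_ifs with h h'
    · have h3 := rowVec_of_lt (v := v) hπ (k := m - 1) (by omega) (by omega) (by omega)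
      rw [h3.1, h3.2]
    · have h3 := rowVec_of_lt (v := v) hπ (k := m + a) (by omega) (by omega) (by omega)
      rw [h3.1, h3.2]
    · obtain ⟨k, hk⟩ : ∃ k, m + (a : ℕ) = k + 1 := ⟨m + a - 1, by omega⟩
      rw [hk]
      exact (rowVec_of_gt hπ (by omega) (by omega)).2
  have h3 : Z s (m + n) = 1 := by
    simp only [Z, ← hr]
    rw [if_neg (by omega), if_pos (by omega), hs, Nat.add_sub_cancel' hp.le,
      rowVec_symm hπ (by omega), Pi.single_eq_same]
  have h4 : ∀ a : Fin n, Z (s.succAbove a) = rowVec r π v r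
      (if (a : ℕ) = 0 then m - 1 else if m + a < π.symm r then m + a else m + 1 + a) := by
    intro a
    by_cases h : m + (a : ℕ) < π.symm r
    · rw [Fin.succAbove_of_castSucc_lt _ _ (by rw [Fin.lt_def, Fin.val_castSucc]; omega), if_pos h]
      simp only [Z, Fin.val_castSucc]
      split_ifs with h0 h5
      · exact (rowVec_of_lt (v := v) hπ (by omega) (by omega) (by omega)).1
      · exact (rowVec_of_lt (v := v) hπ (by omega) (by omega) h).1
      · omega
    · rw [Fin.succAbove_of_le_castSucc _ _ (by rw [Fin.le_def, Fin.val_castSucc]; omega),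
        if_neg (by omega), if_neg h]
      simp only [Z, Fin.val_succ]
      rw [if_neg (by omega), if_neg (by omega), add_assoc, add_comm 1]
  rw [h1, det_expand_last Z s h2, h3, mul_one, ← mul_assoc]
  simp only [h4]
  have h5 : (-1 : F) ^ (s + n : ℕ) = (-1) ^ (r - π.symm r) := by
    have : (s + n : ℕ) = (r - π.symm r) + 2 * (π.symm r - m) := by omega
    rw [this, pow_add, pow_mul]
    simp
  rw [h5, mul_assoc]

end

end SchubertCell

/-! ### The theorem, with `m = r - i + 1` and `n = i - 1`. -/

theorem mainTheorem1 {F : Type*} [Field F] [CharZero F] (r : ℕ) (π : Equiv.Perm ℕ)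
    (hπ : ∀ k, k ∉ Finset.Icc 1 r → π k = k) (v : ℕ → ℕ → F)
    (hv : ∀ p ∈ SchubertCell.invSet r π, v p.1 p.2 ≠ 0)
    (i : ℕ) (hi : 1 ≤ i) (hir : i ≤ r) (hpi : π r < r - i + 1) :
    (∃ s, 1 ≤ s ∧ s ≤ i ∧ SchubertCell.wu r π v (r - i + s) r ≠ 0 ∧
        (∀ t, 1 ≤ t → t < s → SchubertCell.wu r π v (r - i + t) r = 0) ∧
        (SchubertCell.T r π v i).det =
          (-1) ^ (s + i) * SchubertCell.uEntry r π v (π (r - i + s)) r *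
            (SchubertCell.TL r π v i).det) ∧
      (π.symm r < r - i + 1 →
        (SchubertCell.Fmat r π v i).det =
          1 / SchubertCell.nEntry r π v (π (r - i + 1)) r * (SchubertCell.T r π v i).det -
            (-1) ^ i / SchubertCell.nEntry r π v (π (r - i + 1)) r *
              SchubertCell.uEntry r π v (π (r - i + 2)) r * (SchubertCell.FL r π v i).det) ∧
      (r - i + 1 = π.symm r →
        (SchubertCell.Fmat r π v i).det =
          (-1) ^ i * SchubertCell.uEntry r π v (π (r - i + 2)) r *
            (SchubertCell.FL r π v i).det) ∧
      (r - i + 1 < π.symm r →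
        (SchubertCell.Fmat r π v i).det =
          (-1) ^ (r - π.symm r) * (SchubertCell.FL r π v i).det) := by
  replace hπ : SchubertCell.FixesOutside r π := hπ
  obtain ⟨n, rfl⟩ : ∃ n, i = n + 1 := ⟨i - 1, by omega⟩
  obtain ⟨m, hm⟩ : ∃ m, m = r - (n + 1) + 1 := ⟨_, rfl⟩
  have hr : r = m + n := by omega
  have hm1 : r - (n + 1) = m - 1 := by omega
  have hpr := (SchubertCell.mem_Icc_perm hπ r).2 (by omega)
  have hp := (SchubertCell.mem_Icc_perm_symm hπ r).2 (by omega)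
  -- From `1 ≤ π r < m ≤ r`: row `m - 1` exists, and `1_r` is not in the last row. Hence `F_i` has
  -- at least two rows when `1_r` lies in row `m`.
  have hne : π.symm r ≠ r := by
    intro h
    rw [Equiv.symm_apply_eq] at h
    omega
  have hF : SchubertCell.Fmat r π v (n + 1) = Matrix.of fun a c : Fin (n + 1) =>
      SchubertCell.wu r π v (if (a : ℕ) = 0 then m - 1 else m + a) (m + c) := by
    simp only [SchubertCell.Fmat, ← hm]
    simp only [hm1]
  have hT : SchubertCell.T r π v (n + 1) = Matrix.of fun a c : Fin (n + 1) =>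
      SchubertCell.wu r π v (m + a) (m + c) := by
    simp only [SchubertCell.T, ← hm]
  have hm2 : r - (n + 1) + 2 = m + 1 := by omega
  have hFL : ∀ f : ℕ → ℕ, (∀ a < n, SchubertCell.rowF r π (n + 1) a = f a) →
      SchubertCell.FL r π v (n + 1) =
        Matrix.of fun a c : Fin n => SchubertCell.xL r π v (f a) (m + c) := by
    intro f hf
    ext a c
    simp only [SchubertCell.FL, ← hm, Matrix.of_apply]
    rw [hf a a.2]
  -- Column `r` of `wu` vanishes exactly above row `π⁻¹ r`; truncated subtraction gives `s = 1` when
  -- that row lies above `T_i`.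
  refine ⟨⟨π.symm r - m + 1, by omega, by omega, ?_, ?_, ?_⟩, ?_, ?_, ?_⟩
  · rw [SchubertCell.wu_last hπ hv (by omega) (by omega)]
    exact SchubertCell.rowVec_last_ne_zero hπ hv (by omega) (by omega) (by omega)
  · intro t ht1 ht
    exact SchubertCell.wu_last_of_lt hπ hv (by omega) (by omega) (by omega)
  · have h1 := SchubertCell.det_T_eq hπ hv (m := m) (n := n) (by omega) hr
      ⟨π.symm r - m, by omega⟩ rfl
    have hTL : SchubertCell.TL r π v (n + 1) = Matrix.of fun a c : Fin n =>
        SchubertCell.xL r π v (if π.symm r < m then m + 1 + a else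
          if m + a < π.symm r then m + a else m + 1 + a) (m + c) := by
      ext a c
      simp only [SchubertCell.TL, SchubertCell.rowT, ← hm, hm2, Matrix.of_apply]
    have h2 : r - (n + 1) + (π.symm r - m + 1) = m + (π.symm r - m) := by omega
    rw [hT, hTL, h1, h2, SchubertCell.wu]
    ring
  · rw [← hm, hm2]
    intro h
    have h1 := SchubertCell.det_F_of_symm_lt hπ hv (by omega) hr h
    have h2 : SchubertCell.wn r π v m r ≠ 0 := by
      have h3 := (SchubertCell.mem_Icc_perm hπ m).2 (by omega)
      exact SchubertCell.wn_ne_zero hv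
        ((SchubertCell.mem_entries_iff hπ _ _).2 (by omega))
    rw [hF, hT, hFL (fun a => if a = 0 then m else m + 1 + a), h1]
    · rw [SchubertCell.wn] at h2 ⊢
      field_simp
      ring
    · intro a _
      rw [SchubertCell.rowF, ← hm, hm2, if_pos h]
  · rw [← hm, hm2]
    intro h
    obtain ⟨n, rfl⟩ : ∃ l, n = l + 1 := ⟨n - 1, by omega⟩
    have h1 := SchubertCell.det_F_of_symm_eq hπ hv (by omega) hr h.symm
    rw [hF, hFL (fun a => if a = 0 then m - 1 else m + 1 + a), h1]
    intro a _
    rw [SchubertCell.rowF, ← hm, hm2, hm1, if_neg (by omega), if_pos h.symm]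
  · rw [← hm]
    intro h
    have h1 := SchubertCell.det_F_of_lt_symm hπ hv (by omega) hr h
    rw [hF, hFL (fun a => if a = 0 then m - 1 else
      if m + a < π.symm r then m + a else m + 1 + a), h1]
    intro a _
    rw [SchubertCell.rowF, ← hm, hm2, hm1, if_neg (by omega), if_neg (by omega)]
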